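/- Let $\mathbb D$ be the open unit disc, $\mathbb T$ the unit circle, $m$ normalised Lebesgue measure on $\mathbb T$, and $H^2$ the Hardy space of analytic functions $f$ on $\mathbb D$ with $\|f\|_2^2=\sup_{0\le r<1}\int_{\mathbb T}|f(r\zeta)|^2\,dm(\zeta)<\infty$. Let $\varphi:\mathbb D\to\mathbb D$ be an inner function (analytic, with radial limits of modulus one $m$-almost everywhere), with canonical representation $$\varphi(z)=e^{i\alpha}z^N\prod_{n}\frac{|a_n|}{a_n}\,\frac{a_n-z}{1-\overline{a_n}z}\,\exp\left(-\int_{\mathbb T}\frac{\zeta+z}{\zeta-z}\,d\mu(\zeta)\right),$$ where $\alpha\in\mathbb R$, $N\ge 0$ is an integer, $(a_n)$ is the finite or infinite sequence of the zeros of $\varphi$ in $\mathbb D\setminus\{0\}$, repeated according to multiplicity, with $\sum_n(1-|a_n|)<\infty$, and $\mu$ is a finite positive singular Borel measure on $\mathbb T$. Put $$E_\varphi=\left\{\zeta\in\mathbb T:\ \sum_n\frac{1-|a_n|^2}{|\zeta-a_n|^2}+2\int_{\mathbb T}\frac{d\mu(t)}{|t-\zeta|^2}<\infty\right\},\qquad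 \sigma(\varphi)=\overline{\{a_n\}_n}\cup\operatorname{supp}\mu ,$$ and let $\mathcal M_\varphi$ be the set of all $h\in H^2$ for which the weighted composition operator $W_{h,\varphi}f=h\cdot(f\circ\varphi)$ is bounded on $H^2$. Suppose that the zero set of $\varphi$, if infinite, is such that $(a_n)$ is a union of finitely many subsequences, each tending nontangentially to some point of $\mathbb T$, and that $\mu$ has finite support. Then $E_\varphi=\mathbb T\setminus\sigma(\varphi)$, and every $h\in\mathcal M_\varphi$ is essentially bounded on every subset $K$ of $E_\varphi$ that is relatively compact in $E_\varphi$ (that is, $\overline K\subseteq E_\varphi$): there is a constant $C$ such that for $m$-almost every $\zeta\in K$ the radial limit $h(\zeta)=\lim_{r\to1^-}h(r\zeta)$ exists and satisfies $|h(\zeta)|\le C$. -/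

import Mathlib

open Set Filter Topology MeasureTheory
open scoped ENNReal NNReal

/-! The unit circle `𝕋` is Mathlib's `Circle`, the open unit disc `𝔻` is `Metric.ball (0 : ℂ) 1`, and
functions on the disc are functions `ℂ → ℂ` of which only the values on the disc matter. -/

noncomputable section

namespace HardyDisc

/-- The Borel σ-algebra of the unit circle. -/
instance instMeasurableSpaceCircle : MeasurableSpace Circle := borel Circle

instance instBorelSpaceCircle : BorelSpace Circle := ⟨rfl⟩

/-- Normalised Lebesgue measure `dθ / 2π` on the unit circle. -/
def arcMeasure : Measure Circle :=
  (ENNReal.ofReal (2 * Real.pi))⁻¹ •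
    Measure.map Circle.exp (volume.restrict (Ioc 0 (2 * Real.pi)))

/-- The Hardy norm `‖f‖₂ = sup_{0 ≤ r < 1} (∫ |f(r e^{iθ})|² dθ/2π)^{1/2}`, with values in
`[0, ∞]`. -/
def hardyNorm (f : ℂ → ℂ) : ℝ≥0∞ :=
  ⨆ r ∈ Ico (0 : ℝ) 1, eLpNorm (fun ζ : Circle => f (r * ζ)) 2 arcMeasure

/-- Membership of the Hardy space `H²` of the unit disc. -/
def MemHardy (f : ℂ → ℂ) : Prop :=
  DifferentiableOn ℂ f (Metric.ball 0 1) ∧ hardyNorm f < ∞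

/-- `f` has the radial limit `w` at the point `ζ` of the unit circle. -/
def HasRadialLimit (f : ℂ → ℂ) (ζ : Circle) (w : ℂ) : Prop :=
  Tendsto (fun r : ℝ => f (r * ζ)) (𝓝[<] 1) (𝓝 w)

/-- Inner functions: analytic and bounded by one in the disc, with radial limits of modulus one
almost everywhere on the circle. -/
structure IsInner (φ : ℂ → ℂ) : Prop where
  differentiableOn : DifferentiableOn ℂ φ (Metric.ball 0 1)
  norm_le_one : ∀ z ∈ Metric.ball (0 : ℂ) 1, ‖φ z‖ ≤ 1
  radial : ∀ᵐ ζ ∂arcMeasure, ∃ w : ℂ, HasRadialLimit φ ζ w ∧ ‖w‖ = 1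

/-- The weighted composition operator `W_{h,φ} f = h · (f ∘ φ)`. -/
def weightedComp (h φ f : ℂ → ℂ) : ℂ → ℂ := fun z => h z * f (φ z)

/-- The multiplier space `M_φ` of a self-map `φ` of the disc: all `h ∈ H²` for which `W_{h,φ}` is a
bounded operator on `H²`. -/
def multiplierSpace (φ : ℂ → ℂ) : Set (ℂ → ℂ) :=
  {h | MemHardy h ∧ ∃ C : ℝ≥0, ∀ f : ℂ → ℂ, MemHardy f →
    MemHardy (weightedComp h φ f) ∧ hardyNorm (weightedComp h φ f) ≤ C * hardyNorm f}

/-- The Blaschke factor `(|a| / a) (a - z) / (1 - ā z)` with zero `a ≠ 0`. -/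
def blaschkeFactor (a z : ℂ) : ℂ :=
  ((‖a‖ : ℂ) / a) * ((a - z) / (1 - starRingEnd ℂ a * z))

/-- The canonical representation
`φ(z) = e^{iα} z^N ∏ᵢ (|aᵢ|/aᵢ) (aᵢ - z)/(1 - āᵢ z) · exp (-∫ (ζ + z)/(ζ - z) dμ(ζ))`
of an inner function in terms of its zeros `aᵢ` other than the origin, repeated according to
multiplicity (finitely or infinitely many, and subject to the Blaschke condition), and of a finite
positive singular measure `μ` on the circle. -/
structure IsCanonicalRep {ι : Type*} (φ : ℂ → ℂ) (α : ℝ) (N : ℕ) (a : ι → ℂ)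
    (μ : Measure Circle) : Prop where
  ne_zero : ∀ i, a i ≠ 0
  norm_lt_one : ∀ i, ‖a i‖ < 1
  blaschke : Summable fun i => 1 - ‖a i‖
  finite : IsFiniteMeasure μ
  singular : μ ⟂ₘ arcMeasure
  eq : ∀ z ∈ Metric.ball (0 : ℂ) 1, ∃ B : ℂ,
    HasProd (fun i => blaschkeFactor (a i) z) B ∧
    φ z = Complex.exp (α * Complex.I) * z ^ N * B *
      Complex.exp (-∫ ζ : Circle, ((ζ : ℂ) + z) / ((ζ : ℂ) - z) ∂μ)

/-- The Ahern–Clark set: all `ζ ∈ 𝕋` with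
`∑ᵢ (1 - |aᵢ|²) / |ζ - aᵢ|² + 2 ∫ dμ(t) / |t - ζ|² < ∞`, the integrand being `∞` at `t = ζ`. -/
def ahernClarkSet {ι : Type*} (a : ι → ℂ) (μ : Measure Circle) : Set Circle :=
  {ζ | (∑' i, ENNReal.ofReal ((1 - ‖a i‖ ^ 2) / ‖(ζ : ℂ) - a i‖ ^ 2)) +
    2 * ∫⁻ t : Circle, (‖(t : ℂ) - (ζ : ℂ)‖ₑ ^ 2)⁻¹ ∂μ < ∞}

/-- The spectrum `clos {aᵢ} ∪ supp μ`, a subset of the closed disc. -/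
def innerSpectrum {ι : Type*} (a : ι → ℂ) (μ : Measure Circle) : Set ℂ :=
  closure (range a) ∪ (fun t : Circle => (t : ℂ)) '' μ.support

/-- The family `b` of points of the disc tends to the point `p` of the circle nontangentially, i.e.
it converges to `p` and all but finitely many of its members lie in one Stolz domain
`{z : |p - z| ≤ M (1 - |z|)}`. (A sequence tends to a limit along `atTop` on `ℕ` if and only if it
does along the cofinite filter.) -/
def TendsNontangentially {κ : Type*} (b : κ → ℂ) (p : Circle) : Prop :=
  Tendsto b cofinite (𝓝 (p : ℂ)) ∧
    ∃ M : ℝ, ∀ᶠ i in cofinite, ‖(p : ℂ) - b i‖ ≤ M * (1 - ‖b i‖)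

/-- The family `a` is a finite union of subfamilies, each of which tends nontangentially to some
point of the circle. -/
def FiniteUnionNontangential {ι : Type*} (a : ι → ℂ) : Prop :=
  ∃ (k : ℕ) (S : Fin k → Set ι) (p : Fin k → Circle),
    (⋃ j, S j) = univ ∧ ∀ j, TendsNontangentially (fun i : S j => a i) (p j)

/-- `h` is essentially bounded on the set `K ⊆ 𝕋`: for some constant `C`, at almost every point of `K`
the boundary value (radial limit) of `h` exists and has modulus at most `C`. -/
def EssBoundedOn (h : ℂ → ℂ) (K : Set Circle) : Prop :=
  ∃ C : ℝ, ∀ᵐ ζ ∂arcMeasure, ζ ∈ K → ∃ w : ℂ, HasRadialLimit h ζ w ∧ ‖w‖ ≤ C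

end HardyDisc

end

/-! Off the closed spectrum both terms defining `ahernClarkSet` are finite, since all distances are
bounded below. Conversely, a support point is an atom of `μ` because the support is finite, so the
integral is infinite there. At a limit point of the zeros, a subfamily in a Stolz domain contributes
infinitely many terms bounded below. This gives `ahernClarkSet_eq`.

For boundedness, test the operator on the Szegő kernel at `φ w` and evaluate at `w`: this gives `‖h
w‖² ≤ C (1 - ‖φ w‖²) / (1 - ‖w‖)` (`exists_norm_sq_le_of_mem_multiplierSpace`). Near a compact set
off the spectrum, the product formula gives `1 - ‖φ z‖² ≤ A (1 - ‖z‖²)`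
(`IsCanonicalRep.one_sub_norm_sq_le`). The factors `1 - ‖z‖` cancel, so `h` is bounded near that
set.

Radial limits come from a local Fatou theorem (`ae_hasRadialLimit`). Globally `h` grows at most like
`(1 - ‖z‖)^(-1/2)`, which is integrable along radii, so `h` has a primitive `G` continuous on the
closed disc. Where `h` is bounded, `G` is Lipschitz up to the circle, hence differentiable along it
almost everywhere. At such a point a Poisson-type kernel estimate turns the tangential derivative of
`G` into the radial limit of `G' = h`. -/

namespace HardyDisc

/-! ### The Ahern–Clark set is the complement of the spectrum -/

/-- A point off the zeros and off the support of `μ` has a positive distance from both. -/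
theorem mem_ahernClarkSet_of_dist {ι : Type*} {a : ι → ℂ} {μ : Measure Circle}
    [IsFiniteMeasure μ] (hlt : ∀ i, ‖a i‖ < 1) (hs : Summable fun i => 1 - ‖a i‖) {ζ : Circle}
    {δ : ℝ} (hδ : 0 < δ) (ha : ∀ i, δ ≤ ‖(ζ : ℂ) - a i‖)
    (hμ : ∀ t ∈ μ.support, δ ≤ ‖(t : ℂ) - ζ‖) : ζ ∈ ahernClarkSet a μ := by
  have h1 : ∀ i, ENNReal.ofReal ((1 - ‖a i‖ ^ 2) / ‖(ζ : ℂ) - a i‖ ^ 2) ≤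
      ENNReal.ofReal ((1 - ‖a i‖) * (2 / δ ^ 2)) := by
    intro i
    apply ENNReal.ofReal_le_ofReal
    have h0 := norm_nonneg (a i)
    have h2 := hlt i
    calc (1 - ‖a i‖ ^ 2) / ‖(ζ : ℂ) - a i‖ ^ 2 ≤ (1 - ‖a i‖ ^ 2) / δ ^ 2 := by
          have : 0 ≤ 1 - ‖a i‖ ^ 2 := by nlinarith
          gcongr
          exact ha i
      _ ≤ ((1 - ‖a i‖) * 2) / δ ^ 2 := by
          gcongr
          nlinarith
      _ = _ := by ring
  have h2 : ∑' i, ENNReal.ofReal ((1 - ‖a i‖ ^ 2) / ‖(ζ : ℂ) - a i‖ ^ 2) < ∞ :=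
    (ENNReal.tsum_le_tsum h1).trans_lt (hs.mul_right _).tsum_ofReal_lt_top
  have h3 : ∫⁻ t : Circle, (‖(t : ℂ) - (ζ : ℂ)‖ₑ ^ 2)⁻¹ ∂μ ≤
      ∫⁻ _ : Circle, (ENNReal.ofReal δ ^ 2)⁻¹ ∂μ := by
    apply lintegral_mono_ae
    filter_upwards [Measure.support_mem_ae (μ := μ)] with t ht
    gcongr
    rw [← ofReal_norm]
    exact ENNReal.ofReal_le_ofReal (hμ t ht)
  have h4 : ∫⁻ t : Circle, (‖(t : ℂ) - (ζ : ℂ)‖ₑ ^ 2)⁻¹ ∂μ < ∞ := by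
    refine h3.trans_lt ?_
    rw [lintegral_const]
    refine ENNReal.mul_lt_top ?_ (measure_lt_top μ _)
    exact ENNReal.inv_lt_top.2 (ENNReal.pow_pos (ENNReal.ofReal_pos.2 hδ) 2)
  exact ENNReal.add_lt_top.2 ⟨h2, ENNReal.mul_lt_top (by simp) h4⟩

/-- With finite support, a support point has a neighbourhood meeting the support only in itself, so
it is an atom; the integrand is `∞` on it. -/
theorem notMem_support_of_mem_ahernClarkSet {ι : Type*} {a : ι → ℂ} {μ : Measure Circle}
    (hsupp : μ.support.Finite) {ζ : Circle} (hζ : ζ ∈ ahernClarkSet a μ) : ζ ∉ μ.support := by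
  intro hmem
  have h1 : μ {ζ} ≠ 0 := by
    have hU : (μ.support \ {ζ})ᶜ ∈ 𝓝 ζ :=
      (hsupp.subset sdiff_subset).isClosed.isOpen_compl.mem_nhds (by simp)
    have h2 := (Measure.mem_support_iff_forall ζ).1 hmem _ hU
    intro h0
    have h3 : μ ((μ.support \ {ζ})ᶜ) ≤ μ ({ζ} ∪ μ.supportᶜ) := by
      apply measure_mono
      intro x hx
      by_cases hxz : x = ζ
      · exact Or.inl hxz
      · right
        intro hxs
        exact hx ⟨hxs, hxz⟩
    have h4 : μ ({ζ} ∪ μ.supportᶜ) = 0 :=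
      measure_union_null h0 Measure.measure_compl_support
    exact absurd (h3.trans h4.le) (not_le.2 h2)
  have h5 := (ENNReal.add_lt_top.1 hζ).2
  have h6 : ∫⁻ t : Circle, (‖(t : ℂ) - (ζ : ℂ)‖ₑ ^ 2)⁻¹ ∂μ = ∞ := by
    rw [eq_top_iff]
    calc (∞ : ℝ≥0∞) = ∞ * μ {ζ} := (ENNReal.top_mul h1).symm
      _ = ∫⁻ t in {ζ}, (‖(t : ℂ) - (ζ : ℂ)‖ₑ ^ 2)⁻¹ ∂μ := by
          rw [lintegral_singleton]; simp
      _ ≤ _ := setLIntegral_le_lintegral _ _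
  rw [h6] at h5
  simp at h5

theorem TendsNontangentially.eq_of_mem_closure {κ : Type*} {b : κ → ℂ} {p : Circle} {z : ℂ}
    (hb : TendsNontangentially b p) (hz : z ∈ closure (range b)) (hzb : z ∉ range b) :
    z = p ∧ Infinite κ := by
  have hinf : Infinite κ := by
    by_contra h
    rw [not_infinite_iff_finite] at h
    rw [(finite_range b).isClosed.closure_eq] at hz
    exact hzb hz
  refine ⟨?_, hinf⟩
  by_contra hne
  obtain ⟨U, V, hU, hV, hzU, hpV, hUV⟩ := t2_separation hne
  have h1 : {i | b i ∉ V}.Finite := hb.1.eventually (hV.mem_nhds hpV)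
  have h2 : range b ⊆ V ∪ b '' {i | b i ∉ V} := by
    rintro _ ⟨i, rfl⟩
    by_cases hi : b i ∈ V
    · exact Or.inl hi
    · exact Or.inr ⟨i, hi, rfl⟩
  have h3 : z ∈ closure (V ∪ b '' {i | b i ∉ V}) := closure_mono h2 hz
  rw [closure_union, (h1.image b).isClosed.closure_eq] at h3
  rcases h3 with h3 | ⟨i, -, hi⟩
  · obtain ⟨x, hx⟩ := mem_closure_iff.1 h3 U hU hzU
    exact disjoint_left.1 hUV hx.1 hx.2
  · exact hzb ⟨i, hi⟩

/-- In a Stolz domain at `ζ`, `‖ζ - a‖ ≤ M (1 - ‖a‖)`, so each term of the series is at least `(1 -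
‖a‖²) / (M² (1 - ‖a‖)²) ≥ 1 / M²`. Infinitely many such terms cannot have a finite sum. -/
theorem notMem_closure_of_mem_ahernClarkSet {ι : Type*} {a : ι → ℂ} {μ : Measure Circle}
    (hlt : ∀ i, ‖a i‖ < 1)
    (hzeros : (range a).Infinite → FiniteUnionNontangential a) {ζ : Circle}
    (hζ : ζ ∈ ahernClarkSet a μ) : (ζ : ℂ) ∉ closure (range a) := by
  intro hcl
  have hnot : (ζ : ℂ) ∉ range a := by
    rintro ⟨i, hi⟩
    have := hlt i
    rw [hi, Circle.norm_coe] at this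
    exact lt_irrefl _ this
  have hinf : (range a).Infinite := fun hfin => hnot (hfin.isClosed.closure_eq ▸ hcl)
  obtain ⟨k, S, p, hS, hp⟩ := hzeros hinf
  have hun : range a = ⋃ j, range (fun i : S j => a i) := by
    ext x
    constructor
    · rintro ⟨i, rfl⟩
      have : i ∈ ⋃ j, S j := hS ▸ mem_univ i
      obtain ⟨j, hj⟩ := mem_iUnion.1 this
      exact mem_iUnion.2 ⟨j, ⟨i, hj⟩, rfl⟩
    · intro hx
      obtain ⟨j, i, rfl⟩ := mem_iUnion.1 hx
      exact ⟨i, rfl⟩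
  rw [hun, closure_iUnion_of_finite] at hcl
  obtain ⟨j, hj⟩ := mem_iUnion.1 hcl
  obtain ⟨hpj, hinfj⟩ := (hp j).eq_of_mem_closure hj (by
    rintro ⟨i, hi⟩
    exact hnot ⟨i, hi⟩)
  obtain ⟨M, hM⟩ := (hp j).2
  have hsum := (ENNReal.add_lt_top.1 hζ).1
  have hsub : ∑' i : S j, ENNReal.ofReal ((1 - ‖a i‖ ^ 2) / ‖(ζ : ℂ) - a i‖ ^ 2) ≠ ∞ :=
    ((ENNReal.tsum_comp_le_tsum_of_injective Subtype.val_injective _).trans_lt hsum).ne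
  have hfin := ENNReal.finite_const_le_of_tsum_ne_top hsub
    (ε := ENNReal.ofReal (1 / M ^ 2))
  -- `0 < M` is carried along because the threshold `1 / M ^ 2` must be nonzero; any one member of
  -- the infinite subfamily supplies it.
  have hev : ∀ᶠ i : S j in cofinite, ENNReal.ofReal (1 / M ^ 2) ≤
      ENNReal.ofReal ((1 - ‖a i‖ ^ 2) / ‖(ζ : ℂ) - a i‖ ^ 2) ∧ 0 < M := by
    filter_upwards [hM] with i hi
    rw [← hpj] at hi
    have h1 : 0 < ‖(ζ : ℂ) - a i‖ := by
      rw [norm_pos_iff, sub_ne_zero]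
      exact fun h => hnot ⟨i, h.symm⟩
    have h2 := hlt i
    have h3 := norm_nonneg (a i)
    have hM0 : 0 < M := by
      by_contra hneg
      nlinarith
    refine ⟨ENNReal.ofReal_le_ofReal ?_, hM0⟩
    rw [div_le_div_iff₀ (by positivity) (by positivity)]
    calc 1 * ‖(ζ : ℂ) - a i‖ ^ 2 ≤ (M * (1 - ‖a i‖)) ^ 2 := by rw [one_mul]; gcongr
      _ = ((1 - ‖a i‖) * (1 - ‖a i‖)) * M ^ 2 := by ring
      _ ≤ (1 - ‖a i‖ ^ 2) * M ^ 2 := by gcongr; nlinarith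
  obtain ⟨i0, hi0⟩ := hev.exists
  have h4 := hfin (by simp [hi0.2])
  exact h4.not_infinite (by
    have h5 : {i : S j | ¬ (ENNReal.ofReal (1 / M ^ 2) ≤
      ENNReal.ofReal ((1 - ‖a i‖ ^ 2) / ‖(ζ : ℂ) - a i‖ ^ 2))}.Finite :=
      hev.mono fun i hi => hi.1
    have := h5.infinite_compl
    simpa [compl_ofPred] using this)

theorem isClosed_innerSpectrum {ι : Type*} {a : ι → ℂ} {μ : Measure Circle} :
    IsClosed (innerSpectrum a μ) :=
  isClosed_closure.union (Measure.isClosed_support.isCompact.image (by fun_prop)).isClosed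

theorem ahernClarkSet_eq {ι : Type*} {a : ι → ℂ} {μ : Measure Circle} [IsFiniteMeasure μ]
    (hlt : ∀ i, ‖a i‖ < 1) (hs : Summable fun i => 1 - ‖a i‖)
    (hzeros : (range a).Infinite → FiniteUnionNontangential a) (hsupp : μ.support.Finite) :
    ahernClarkSet a μ = {ζ : Circle | (ζ : ℂ) ∉ innerSpectrum a μ} := by
  ext ζ
  constructor
  · rintro hζ (h | ⟨t, ht, htz⟩)
    · exact notMem_closure_of_mem_ahernClarkSet hlt hzeros hζ h
    · rw [Circle.ext htz] at ht
      exact notMem_support_of_mem_ahernClarkSet hsupp hζ ht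
  · intro hζ
    obtain ⟨δ, hδ, hball⟩ := Metric.isOpen_iff.1
      (isClosed_innerSpectrum (a := a) (μ := μ)).isOpen_compl (ζ : ℂ) hζ
    have key : ∀ x ∈ innerSpectrum a μ, δ ≤ ‖x - ζ‖ := by
      intro x hx
      by_contra hlt
      exact hball (mem_ball_iff_norm.2 (not_le.1 hlt)) hx
    refine mem_ahernClarkSet_of_dist hlt hs hδ (fun i => ?_) fun t ht => key _ (Or.inr ⟨t, ht, rfl⟩)
    rw [norm_sub_rev]
    exact key _ (Or.inl (subset_closure ⟨i, rfl⟩))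

/-! ### Bounds for `1 - ‖φ z‖²` away from the spectrum -/

theorem one_sub_mul_le_add {x y : ℝ} (hx1 : x ≤ 1) (hy1 : y ≤ 1) :
    1 - x * y ≤ (1 - x) + (1 - y) := by
  nlinarith

theorem one_sub_prod_le_sum {ι : Type*} (s : Finset ι) {x : ι → ℝ} (h0 : ∀ i, 0 ≤ x i)
    (h1 : ∀ i, x i ≤ 1) : 1 - ∏ i ∈ s, x i ≤ ∑ i ∈ s, (1 - x i) := by
  classical
  induction s using Finset.induction_on with
  | empty => simp
  | insert i s hi ih =>
    rw [Finset.prod_insert hi, Finset.sum_insert hi]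
    have := one_sub_mul_le_add (h1 i)
      (Finset.prod_le_one (s := s) (fun i _ => h0 i) fun i _ => h1 i)
    linarith

theorem one_sub_pow_le {x : ℝ} (h0 : 0 ≤ x) (h1 : x ≤ 1) (n : ℕ) : 1 - x ^ n ≤ n * (1 - x) := by
  simpa only [Finset.prod_const, Finset.sum_const, Finset.card_range, nsmul_eq_mul] using
    one_sub_prod_le_sum (Finset.range n) (x := fun _ => x) (fun _ => h0) fun _ => h1

theorem one_sub_conj_mul_ne_zero {a z : ℂ} (ha : ‖a‖ < 1) (hz : ‖z‖ < 1) :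
    1 - starRingEnd ℂ a * z ≠ 0 := by
  intro h
  have h1 : ‖starRingEnd ℂ a * z‖ = 1 := by rw [← sub_eq_zero.1 h]; simp
  rw [norm_mul, RCLike.norm_conj] at h1
  nlinarith [norm_nonneg a, norm_nonneg z]

theorem one_sub_norm_blaschkeFactor_sq {a z : ℂ} (ha0 : a ≠ 0) (ha : ‖a‖ < 1) (hz : ‖z‖ < 1) :
    1 - ‖blaschkeFactor a z‖ ^ 2 =
      (1 - ‖a‖ ^ 2) * (1 - ‖z‖ ^ 2) / ‖1 - starRingEnd ℂ a * z‖ ^ 2 := by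
  have hd : ‖1 - starRingEnd ℂ a * z‖ ≠ 0 := norm_ne_zero_iff.2 (one_sub_conj_mul_ne_zero ha hz)
  have h1 : ‖blaschkeFactor a z‖ = ‖a - z‖ / ‖1 - starRingEnd ℂ a * z‖ := by
    rw [blaschkeFactor, norm_mul, norm_div, norm_div]
    simp [ha0]
  rw [h1, div_pow, eq_div_iff (by positivity), sub_mul, div_mul_cancel₀ _ (by positivity)]
  simp only [← Complex.normSq_eq_norm_sq, Complex.normSq_apply, Complex.sub_re, Complex.sub_im,
    Complex.mul_re, Complex.mul_im, Complex.conj_re, Complex.conj_im, Complex.one_re,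
    Complex.one_im]
  ring

/-- On the circle `‖1 - conj a * ζ‖ = ‖ζ - a‖`, and replacing `ζ` by `z` changes the left side by at
most `‖z - ζ‖`. -/
theorem norm_sub_le_norm_one_sub_conj_mul (a z : ℂ) (ζ : Circle) (ha : ‖a‖ < 1) :
    ‖(ζ : ℂ) - a‖ - ‖z - ζ‖ ≤ ‖1 - starRingEnd ℂ a * z‖ := by
  have h1 : ‖(ζ : ℂ) - a‖ = ‖1 - starRingEnd ℂ a * ζ‖ := by
    have h : 1 - starRingEnd ℂ a * ζ = starRingEnd ℂ ((ζ : ℂ) - a) * ζ := by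
      rw [map_sub, sub_mul, ← Circle.coe_inv_eq_conj, ← Circle.coe_mul]
      simp
    rw [h, norm_mul, RCLike.norm_conj, Circle.norm_coe, mul_one]
  have h2 : 1 - starRingEnd ℂ a * ζ = (1 - starRingEnd ℂ a * z) + starRingEnd ℂ a * (z - ζ) := by
    ring
  have h3 : ‖starRingEnd ℂ a * (z - ζ)‖ ≤ ‖z - ζ‖ := by
    rw [norm_mul, RCLike.norm_conj]
    nlinarith [norm_nonneg (z - ζ)]
  rw [h1, h2]
  linarith [norm_add_le (1 - starRingEnd ℂ a * z) (starRingEnd ℂ a * (z - ζ))]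

theorem norm_blaschkeFactor_sq_le_one {a z : ℂ} (ha0 : a ≠ 0) (ha : ‖a‖ < 1) (hz : ‖z‖ < 1) :
    ‖blaschkeFactor a z‖ ^ 2 ≤ 1 := by
  have h := one_sub_norm_blaschkeFactor_sq ha0 ha hz
  have h1 : 0 ≤ (1 - ‖a‖ ^ 2) * (1 - ‖z‖ ^ 2) := by
    apply mul_nonneg <;> nlinarith [norm_nonneg a, norm_nonneg z]
  have : 0 ≤ 1 - ‖blaschkeFactor a z‖ ^ 2 := by rw [h]; positivity
  linarith

/-- The defect `1 - ∏ xᵢ` is at most the sum of the defects `1 - xᵢ`. For each factor the defect is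
explicit, and the Blaschke condition makes the sum bounded uniformly over finite subproducts. -/
theorem one_sub_norm_blaschkeProduct_sq_le {ι : Type*} {a : ι → ℂ} (ha0 : ∀ i, a i ≠ 0)
    (ha : ∀ i, ‖a i‖ < 1) (hs : Summable fun i => 1 - ‖a i‖) {z B : ℂ} (hz : ‖z‖ < 1)
    (hB : HasProd (fun i => blaschkeFactor (a i) z) B) {d : ℝ} (hd : 0 < d)
    (hda : ∀ i, d ≤ ‖1 - starRingEnd ℂ (a i) * z‖) :
    1 - ‖B‖ ^ 2 ≤ 2 * (∑' i, (1 - ‖a i‖)) / d ^ 2 * (1 - ‖z‖ ^ 2) := by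
  have hz0 : 0 ≤ 1 - ‖z‖ ^ 2 := by nlinarith [norm_nonneg z]
  have hlim : Tendsto (fun s : Finset ι => 1 - ‖∏ i ∈ s, blaschkeFactor (a i) z‖ ^ 2) atTop
      (𝓝 (1 - ‖B‖ ^ 2)) := ((Tendsto.norm hB).pow 2).const_sub 1
  refine le_of_tendsto' hlim fun s => ?_
  rw [norm_prod, ← Finset.prod_pow]
  refine (one_sub_prod_le_sum s (fun i => by positivity)
    fun i => norm_blaschkeFactor_sq_le_one (ha0 i) (ha i) hz).trans ?_
  calc ∑ i ∈ s, (1 - ‖blaschkeFactor (a i) z‖ ^ 2)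
      ≤ ∑ i ∈ s, (1 - ‖a i‖) * (2 / d ^ 2 * (1 - ‖z‖ ^ 2)) := by
        apply Finset.sum_le_sum
        intro i _
        have h0 := norm_nonneg (a i)
        have h1 := ha i
        rw [one_sub_norm_blaschkeFactor_sq (ha0 i) h1 hz]
        have h2 : 0 ≤ 1 - ‖a i‖ ^ 2 := by nlinarith
        calc _ ≤ (1 - ‖a i‖ ^ 2) * (1 - ‖z‖ ^ 2) / d ^ 2 := by
              gcongr
              exact hda i
          _ ≤ (2 * (1 - ‖a i‖)) * (1 - ‖z‖ ^ 2) / d ^ 2 := by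
              gcongr
              nlinarith
          _ = _ := by ring
    _ = (∑ i ∈ s, (1 - ‖a i‖)) * (2 / d ^ 2 * (1 - ‖z‖ ^ 2)) := by rw [Finset.sum_mul]
    _ ≤ (∑' i, (1 - ‖a i‖)) * (2 / d ^ 2 * (1 - ‖z‖ ^ 2)) := by
        gcongr
        exact hs.sum_le_tsum s fun i _ => by linarith [ha i]
    _ = _ := by ring

theorem re_herglotz (ζ : Circle) (z : ℂ) :
    (((ζ : ℂ) + z) / ((ζ : ℂ) - z)).re = (1 - ‖z‖ ^ 2) / ‖(ζ : ℂ) - z‖ ^ 2 := by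
  have := congrFun (poissonKernel_eq_re_herglotzRieszKernel (c := 0) (w := z)) (ζ : ℂ)
  simpa [poissonKernel, herglotzRieszKernel, Circle.norm_coe ζ] using this.symm

theorem integrable_herglotz {μ : Measure Circle} [IsFiniteMeasure μ] {z : ℂ} (hz : ‖z‖ < 1) :
    Integrable (fun ζ : Circle => ((ζ : ℂ) + z) / ((ζ : ℂ) - z)) μ := by
  apply Continuous.integrable_of_hasCompactSupport _ (HasCompactSupport.of_compactSpace _)
  refine Continuous.div (by fun_prop) (by fun_prop) fun ζ h => ?_
  rw [← sub_eq_zero.1 h, Circle.norm_coe] at hz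
  exact lt_irrefl _ hz

theorem re_integral_herglotz {μ : Measure Circle} [IsFiniteMeasure μ] {z : ℂ} (hz : ‖z‖ < 1) :
    (∫ ζ : Circle, ((ζ : ℂ) + z) / ((ζ : ℂ) - z) ∂μ).re =
      ∫ ζ : Circle, (1 - ‖z‖ ^ 2) / ‖(ζ : ℂ) - z‖ ^ 2 ∂μ := by
  have := integral_re (𝕜 := ℂ) (integrable_herglotz (μ := μ) hz)
  simp only [RCLike.re_eq_complex_re, re_herglotz] at this
  exact this.symm

theorem norm_singularInner_sq {μ : Measure Circle} [IsFiniteMeasure μ] {z : ℂ} (hz : ‖z‖ < 1) :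
    ‖Complex.exp (-∫ ζ : Circle, ((ζ : ℂ) + z) / ((ζ : ℂ) - z) ∂μ)‖ ^ 2 =
      Real.exp (-(2 * ∫ ζ : Circle, (1 - ‖z‖ ^ 2) / ‖(ζ : ℂ) - z‖ ^ 2 ∂μ)) := by
  rw [Complex.norm_exp, Complex.neg_re, re_integral_herglotz hz, ← Real.exp_nat_mul]
  congr 1
  push_cast
  ring

/-- The squared modulus is `exp (-2P)` with `P` the Poisson integral of `μ`; apply `1 - exp (-x) ≤
x` and bound the kernel on the support. -/
theorem one_sub_norm_singularInner_sq_le {μ : Measure Circle} [IsFiniteMeasure μ] {z : ℂ}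
    (hz : ‖z‖ < 1) {d : ℝ} (hd : 0 < d) (hdμ : ∀ t ∈ μ.support, d ≤ ‖(t : ℂ) - z‖) :
    1 - ‖Complex.exp (-∫ ζ : Circle, ((ζ : ℂ) + z) / ((ζ : ℂ) - z) ∂μ)‖ ^ 2 ≤
      2 * μ.real univ / d ^ 2 * (1 - ‖z‖ ^ 2) := by
  have hz0 : 0 ≤ 1 - ‖z‖ ^ 2 := by nlinarith [norm_nonneg z]
  rw [norm_singularInner_sq hz]
  have h1 : ∫ ζ : Circle, (1 - ‖z‖ ^ 2) / ‖(ζ : ℂ) - z‖ ^ 2 ∂μ ≤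
      ∫ _ : Circle, (1 - ‖z‖ ^ 2) / d ^ 2 ∂μ := by
    apply integral_mono_of_nonneg (ae_of_all _ fun ζ => by positivity) (integrable_const _)
    filter_upwards [Measure.support_mem_ae (μ := μ)] with t ht
    gcongr
    exact hdμ t ht
  rw [integral_const, smul_eq_mul] at h1
  have h2 := Real.add_one_le_exp (-(2 * ∫ ζ : Circle, (1 - ‖z‖ ^ 2) / ‖(ζ : ℂ) - z‖ ^ 2 ∂μ))
  calc _ ≤ 2 * (μ.real univ * ((1 - ‖z‖ ^ 2) / d ^ 2)) := by linarith
    _ = _ := by ring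

/-- Away from its spectrum, an inner function satisfies `1 - |φ(z)|² ≤ A (1 - |z|²)`. -/
theorem IsCanonicalRep.one_sub_norm_sq_le {ι : Type*} {φ : ℂ → ℂ} {α : ℝ} {N : ℕ} {a : ι → ℂ}
    {μ : Measure Circle} (hrep : IsCanonicalRep φ α N a μ) {δ : ℝ} (hδ : 0 < δ) :
    ∃ A : ℝ, 0 ≤ A ∧ ∀ ζ : Circle, (∀ i, δ ≤ ‖(ζ : ℂ) - a i‖) →
      (∀ t ∈ μ.support, δ ≤ ‖(t : ℂ) - ζ‖) → ∀ z : ℂ, ‖z‖ < 1 → ‖z - ζ‖ ≤ δ / 2 →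
      1 - ‖φ z‖ ^ 2 ≤ A * (1 - ‖z‖ ^ 2) := by
  have := hrep.finite
  have hT : 0 ≤ ∑' i, (1 - ‖a i‖) := tsum_nonneg fun i => by linarith [hrep.norm_lt_one i]
  -- One summand each for `z ^ N`, the Blaschke product and the singular factor; `δ / 2` is the
  -- distance left after moving from `ζ` to `z`.
  refine ⟨N + 2 * (∑' i, (1 - ‖a i‖)) / (δ / 2) ^ 2 + 2 * μ.real univ / (δ / 2) ^ 2,
    by positivity, fun ζ hζa hζμ z hz hzζ => ?_⟩
  have hz0 : 0 ≤ 1 - ‖z‖ ^ 2 := by nlinarith [norm_nonneg z]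
  have hδ2 : 0 < δ / 2 := by positivity
  obtain ⟨B, hB, hφ⟩ := hrep.eq z (by simpa using hz)
  have h1 := one_sub_norm_blaschkeProduct_sq_le hrep.ne_zero hrep.norm_lt_one hrep.blaschke hz hB
    hδ2 fun i => by
      linarith [norm_sub_le_norm_one_sub_conj_mul (a i) z ζ (hrep.norm_lt_one i), hζa i]
  have h2 := one_sub_norm_singularInner_sq_le (μ := μ) hz hδ2 fun t ht => by
    have := norm_sub_le_norm_sub_add_norm_sub (t : ℂ) z ζ
    linarith [hζμ t ht]
  have hz1 : ‖z‖ ^ 2 ≤ 1 := by linarith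
  have h3 := one_sub_pow_le (by positivity) hz1 N
  have hB1 : ‖B‖ ^ 2 ≤ 1 := by
    have hlim : Tendsto (fun s : Finset ι => ‖∏ i ∈ s, blaschkeFactor (a i) z‖ ^ 2) atTop
      (𝓝 (‖B‖ ^ 2)) := (Tendsto.norm hB).pow 2
    refine le_of_tendsto' hlim fun s => ?_
    rw [norm_prod, ← Finset.prod_pow]
    exact Finset.prod_le_one (fun i _ => by positivity)
      fun i _ => norm_blaschkeFactor_sq_le_one (hrep.ne_zero i) (hrep.norm_lt_one i) hz
  have hS1 : ‖Complex.exp (-∫ ζ : Circle, ((ζ : ℂ) + z) / ((ζ : ℂ) - z) ∂μ)‖ ^ 2 ≤ 1 := by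
    rw [norm_singularInner_sq hz, Real.exp_le_one_iff, neg_nonpos]
    exact mul_nonneg zero_le_two (integral_nonneg fun t => by positivity)
  have hP1 : (‖z‖ ^ 2) ^ N ≤ 1 := pow_le_one₀ (by positivity) hz1
  rw [hφ, norm_mul, norm_mul, norm_mul, Complex.norm_exp_ofReal_mul_I, norm_pow, one_mul,
    mul_pow, mul_pow, ← pow_mul, mul_comm N 2, pow_mul]
  have h4 := one_sub_mul_le_add hP1 hB1
  have h5 := one_sub_mul_le_add (x := (‖z‖ ^ 2) ^ N * ‖B‖ ^ 2)
    (mul_le_one₀ hP1 (by positivity) hB1) hS1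
  linarith

/-! ### Hardy space estimates and the growth of multipliers -/

theorem circleAverage_poissonKernel {w : ℂ} (hw : ‖w‖ < 1) :
    Real.circleAverage (poissonKernel 0 w) 0 1 = 1 := by
  have hb : w ∈ Metric.ball (0 : ℂ) 1 := by simpa using hw
  have h := InnerProductSpace.HarmonicContOnCl.circleAverage_poissonKernel_smul
    (f := fun _ : ℂ => (1 : ℝ)) (c := 0) (R := 1) (w := w) ⟨fun _ _ => by
      exact InnerProductSpace.harmonicAt_const _, continuousOn_const⟩ hb
  simpa [Pi.mul_def] using h

theorem eLpNorm_sq_eq_circleAverage {f : ℂ → ℂ} {r : ℝ}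
    (hf : Continuous fun ζ : Circle => f (r * ζ)) :
    eLpNorm (fun ζ : Circle => f (r * ζ)) 2 arcMeasure ^ 2 =
      ENNReal.ofReal (Real.circleAverage (fun z => ‖f z‖ ^ 2) 0 r) := by
  have hpi : 0 ≤ 2 * Real.pi := by positivity
  have h1 := eLpNorm_nnreal_pow_eq_lintegral (f := fun ζ : Circle => f (r * ζ)) (p := 2)
    (μ := arcMeasure) two_ne_zero
  have hcirc : ∀ θ : ℝ, circleMap 0 r θ = r * (Circle.exp θ : ℂ) := fun θ => by
    rw [circleMap, Circle.coe_exp, zero_add]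
  have hc : Continuous fun θ : ℝ => ‖f (circleMap 0 r θ)‖ ^ 2 := by
    simp only [hcirc]
    exact (hf.comp (Circle.exp).continuous).norm.pow 2
  calc _ = ∫⁻ ζ : Circle, ‖f (r * ζ)‖ₑ ^ (2 : ℝ) ∂arcMeasure := by simpa using h1
    _ = (ENNReal.ofReal (2 * Real.pi))⁻¹ * ∫⁻ θ in Ioc 0 (2 * Real.pi),
        ENNReal.ofReal (‖f (circleMap 0 r θ)‖ ^ 2) := by
      rw [arcMeasure, lintegral_smul_measure, smul_eq_mul, lintegral_map (by
        exact (hf.enorm.measurable.pow_const _)) (Circle.exp).continuous.measurable]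
      congr 2
      ext θ
      rw [hcirc, ENNReal.ofReal_pow (norm_nonneg _), ofReal_norm, ← ENNReal.rpow_natCast]
      simp
    _ = _ := by
      rw [Real.circleAverage, intervalIntegral.integral_of_le hpi, smul_eq_mul,
        ENNReal.ofReal_mul (p := (2 * Real.pi)⁻¹) (by positivity), ENNReal.ofReal_inv_of_pos (by positivity),
        ofReal_integral_eq_lintegral_ofReal]
      · exact (intervalIntegrable_iff_integrableOn_Ioc_of_le hpi).1 (hc.intervalIntegrable _ _)
      · exact ae_of_all _ fun θ => by positivity

theorem continuous_circle_dilation {f : ℂ → ℂ} (hf : DifferentiableOn ℂ f (Metric.ball 0 1))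
    {r : ℝ} (hr0 : 0 ≤ r) (hr : r < 1) : Continuous fun ζ : Circle => f (r * ζ) := by
  refine hf.continuousOn.comp_continuous (by fun_prop) fun ζ => ?_
  rw [mem_ball_zero_iff, norm_mul, Circle.norm_coe, mul_one, Complex.norm_real]
  rwa [Real.norm_of_nonneg hr0]

theorem circleAverage_norm_sq_le {f : ℂ → ℂ} (hf : MemHardy f) {r : ℝ} (hr0 : 0 ≤ r)
    (hr : r < 1) :
    Real.circleAverage (fun z => ‖f z‖ ^ 2) 0 r ≤ (hardyNorm f).toReal ^ 2 := by
  have h1 : eLpNorm (fun ζ : Circle => f (r * ζ)) 2 arcMeasure ≤ hardyNorm f :=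
    le_iSup₂_of_le (f := fun (r : ℝ) (_ : r ∈ Ico (0 : ℝ) 1) =>
      eLpNorm (fun ζ : Circle => f (r * ζ)) 2 arcMeasure) r ⟨hr0, hr⟩ le_rfl
  have h2 := eLpNorm_sq_eq_circleAverage (continuous_circle_dilation hf.1 hr0 hr)
  have h3 : ENNReal.ofReal (Real.circleAverage (fun z => ‖f z‖ ^ 2) 0 r) ≤ hardyNorm f ^ 2 := by
    rw [← h2]
    gcongr
  rw [← ENNReal.toReal_pow]
  exact (ENNReal.ofReal_le_iff_le_toReal (ENNReal.pow_lt_top hf.2).ne).1 h3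

theorem hardyNorm_le_of_circleAverage_le {f : ℂ → ℂ}
    (hf : DifferentiableOn ℂ f (Metric.ball 0 1)) {M : ℝ} (hM : 0 ≤ M)
    (h : ∀ r : ℝ, 0 ≤ r → r < 1 → Real.circleAverage (fun z => ‖f z‖ ^ 2) 0 r ≤ M ^ 2) :
    hardyNorm f ≤ ENNReal.ofReal M := by
  refine iSup₂_le fun r hr => ?_
  have h2 := eLpNorm_sq_eq_circleAverage (continuous_circle_dilation hf hr.1 hr.2)
  refine (ENNReal.pow_le_pow_left_iff two_ne_zero).1 ?_
  rw [h2, ← ENNReal.ofReal_pow hM]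
  exact ENNReal.ofReal_le_ofReal (h r hr.1 hr.2)

theorem norm_circleAverage_le {f : ℂ → ℂ} {g : ℂ → ℝ} {R : ℝ} (hg : CircleIntegrable g 0 R)
    (h : ∀ z ∈ Metric.sphere (0 : ℂ) |R|, ‖f z‖ ≤ g z) :
    ‖Real.circleAverage f 0 R‖ ≤ Real.circleAverage g 0 R := by
  rw [Real.circleAverage, Real.circleAverage, norm_smul, smul_eq_mul,
    Real.norm_of_nonneg (by positivity)]
  gcongr
  exact intervalIntegral.norm_integral_le_of_norm_le Real.two_pi_pos.le
    (ae_of_all _ fun θ _ => h _ (circleMap_mem_sphere' _ _ _)) hg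

/-- Point evaluation at `w` is bounded on `H²`. -/
theorem MemHardy.norm_sq_le {f : ℂ → ℂ} (hf : MemHardy f) {w : ℂ} (hw : ‖w‖ < 1) :
    ‖f w‖ ^ 2 ≤ 4 / (1 - ‖w‖) * (hardyNorm f).toReal ^ 2 := by
  set ρ : ℝ := (1 + ‖w‖) / 2 with hρ
  have hw0 := norm_nonneg w
  have hρ0 : 0 < ρ := by positivity
  have hρ1 : ρ < 1 := by rw [hρ]; linarith
  have hwρ : ‖w‖ < ρ := by rw [hρ]; linarith
  have hsub : Metric.closedBall (0 : ℂ) ρ ⊆ Metric.ball 0 1 := Metric.closedBall_subset_ball hρ1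
  -- The Poisson formula for the analytic function `f ^ 2` bounds `‖f w‖²` by a Poisson average of
  -- `‖f‖²`, with no appeal to subharmonicity or to boundary values.
  have hd : DiffContOnCl ℂ (fun z => f z ^ 2) (Metric.ball 0 ρ) := by
    apply DifferentiableOn.diffContOnCl
    exact (hf.1.pow 2).mono (Metric.closure_ball_subset_closedBall.trans hsub)
  have hP := hd.circleAverage_poissonKernel_smul (w := w) (by simpa using hwρ)
  have hint : CircleIntegrable (fun z => (4 / (1 - ‖w‖)) * ‖f z‖ ^ 2) 0 ρ := by
    apply ContinuousOn.circleIntegrable hρ0.le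
    exact ((hf.1.continuousOn.mono (Metric.sphere_subset_closedBall.trans hsub)).norm.pow
      2).const_mul _
  have hle := norm_circleAverage_le (f := poissonKernel 0 w • fun z => f z ^ 2) hint (by
    intro z hz
    rw [abs_of_pos hρ0] at hz
    have hz' : ‖z‖ = ρ := by simpa using hz
    rw [Pi.smul_apply', norm_smul, norm_pow]
    gcongr
    rw [poissonKernel_def, sub_zero, sub_zero, hz', Real.norm_eq_abs, abs_of_nonneg (by
      apply div_nonneg _ (by positivity)
      nlinarith)]
    have h1 : ρ - ‖w‖ ≤ ‖z - w‖ := by rw [← hz']; exact norm_sub_norm_le z w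
    have h2 : ρ - ‖w‖ = (1 - ‖w‖) / 2 := by rw [hρ]; ring
    have h3 : 0 < ρ - ‖w‖ := by linarith
    calc (ρ ^ 2 - ‖w‖ ^ 2) / ‖z - w‖ ^ 2 ≤ (ρ ^ 2 - ‖w‖ ^ 2) / (ρ - ‖w‖) ^ 2 := by
          have : 0 ≤ ρ ^ 2 - ‖w‖ ^ 2 := by nlinarith
          gcongr
      _ = (ρ + ‖w‖) / (ρ - ‖w‖) := by
          rw [div_eq_div_iff (by positivity) h3.ne']; ring
      _ ≤ 2 / (ρ - ‖w‖) := by gcongr; linarith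
      _ = 4 / (1 - ‖w‖) := by
          rw [h2, div_div_eq_mul_div]; norm_num)
  rw [hP, norm_pow] at hle
  refine hle.trans ?_
  have h5 := Real.circleAverage_fun_smul (𝕜 := ℝ) (a := 4 / (1 - ‖w‖)) (f := fun z => ‖f z‖ ^ 2)
    (c := 0) (R := ρ)
  simp only [smul_eq_mul] at h5
  rw [h5]
  have : 0 < 1 - ‖w‖ := by linarith
  gcongr
  exact circleAverage_norm_sq_le hf hρ0.le hρ1

/-- The Szegő kernel at a point `l` of the disc. -/
noncomputable def szegoKernel (l z : ℂ) : ℂ := (1 - starRingEnd ℂ l * z)⁻¹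

theorem differentiableOn_szegoKernel {l : ℂ} (hl : ‖l‖ < 1) :
    DifferentiableOn ℂ (szegoKernel l) (Metric.ball 0 1) := by
  intro z hz
  apply DifferentiableAt.differentiableWithinAt
  exact DifferentiableAt.inv (by fun_prop) (one_sub_conj_mul_ne_zero hl (by simpa using hz))

/-- For `‖z‖ = 1` one has `‖1 - conj l * (r * z)‖ = ‖z - r * l‖`, so the integrand is a constant
multiple of the Poisson kernel at `r * l`, whose average is one. -/
theorem circleAverage_norm_szegoKernel_sq {l : ℂ} (hl : ‖l‖ < 1) {r : ℝ} (hr0 : 0 ≤ r)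
    (hr : r < 1) :
    Real.circleAverage (fun z => ‖szegoKernel l z‖ ^ 2) 0 r = (1 - ‖r * l‖ ^ 2)⁻¹ := by
  have hrl : ‖(r : ℂ) * l‖ < 1 := by
    rw [norm_mul, Complex.norm_real, Real.norm_of_nonneg hr0]
    nlinarith [norm_nonneg l]
  have h0 : 0 < 1 - ‖(r : ℂ) * l‖ ^ 2 := by nlinarith [norm_nonneg ((r : ℂ) * l)]
  rw [Real.circleAverage_eq_circleAverage_zero_one]
  have h1 : Real.circleAverage (fun z => ‖szegoKernel l ((r : ℂ) * z + 0)‖ ^ 2) 0 1 =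
      Real.circleAverage (fun z => (1 - ‖(r : ℂ) * l‖ ^ 2)⁻¹ • poissonKernel 0 (r * l) z) 0 1 := by
    apply Real.circleAverage_congr_sphere
    intro z hz
    have hz1 : ‖z‖ = 1 := by simpa using hz
    have h2 : ‖1 - starRingEnd ℂ l * (r * z)‖ = ‖z - r * l‖ := by
      have h3 : starRingEnd ℂ z * z = 1 := by
        rw [← Complex.normSq_eq_conj_mul_self, Complex.normSq_eq_norm_sq, hz1]; simp
      have h4 : 1 - starRingEnd ℂ l * (r * z) = starRingEnd ℂ (z - r * l) * z := by
        rw [map_sub, map_mul, Complex.conj_ofReal, sub_mul, h3]; ring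
      rw [h4, norm_mul, RCLike.norm_conj, hz1, mul_one]
    simp only [szegoKernel, add_zero, norm_inv, h2, poissonKernel_def, sub_zero, hz1, smul_eq_mul]
    field_simp
  rw [h1, Real.circleAverage_fun_smul]
  have h6 : Real.circleAverage (fun z => poissonKernel 0 (r * l) z) 0 1 = 1 :=
    circleAverage_poissonKernel hrl
  rw [h6]
  simp

theorem memHardy_szegoKernel {l : ℂ} (hl : ‖l‖ < 1) :
    MemHardy (szegoKernel l) ∧
      (hardyNorm (szegoKernel l)).toReal ^ 2 ≤ (1 - ‖l‖ ^ 2)⁻¹ := by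
  have hl0 : 0 < 1 - ‖l‖ ^ 2 := by nlinarith [norm_nonneg l]
  have h := hardyNorm_le_of_circleAverage_le (differentiableOn_szegoKernel hl)
    (Real.sqrt_nonneg (1 - ‖l‖ ^ 2)⁻¹) (by
    intro r hr0 hr
    rw [circleAverage_norm_szegoKernel_sq hl hr0 hr, Real.sq_sqrt (by positivity)]
    have : ‖(r : ℂ) * l‖ ≤ ‖l‖ := by
      rw [norm_mul, Complex.norm_real, Real.norm_of_nonneg hr0]
      nlinarith [norm_nonneg l]
    gcongr)
  refine ⟨⟨differentiableOn_szegoKernel hl, h.trans_lt ENNReal.ofReal_lt_top⟩, ?_⟩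
  have h2 := ENNReal.toReal_mono ENNReal.ofReal_ne_top h
  rw [ENNReal.toReal_ofReal (Real.sqrt_nonneg _)] at h2
  calc _ ≤ (Real.sqrt (1 - ‖l‖ ^ 2)⁻¹) ^ 2 := by gcongr
    _ = _ := Real.sq_sqrt (by positivity)

/-- A multiplier `h` satisfies `|h(w)|² ≤ C (1 - |φ(w)|²) / (1 - |w|)`. -/
theorem exists_norm_sq_le_of_mem_multiplierSpace {φ h : ℂ → ℂ}
    (hself : MapsTo φ (Metric.ball 0 1) (Metric.ball 0 1)) (hh : h ∈ multiplierSpace φ) :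
    ∃ C : ℝ, 0 ≤ C ∧ ∀ w : ℂ, ‖w‖ < 1 →
      ‖h w‖ ^ 2 ≤ C * (1 - ‖φ w‖ ^ 2) / (1 - ‖w‖) := by
  obtain ⟨-, C, hC⟩ := hh
  refine ⟨4 * (C : ℝ) ^ 2, by positivity, fun w hw => ?_⟩
  have hl : ‖φ w‖ < 1 := by simpa using hself (show w ∈ Metric.ball 0 1 by simpa using hw)
  have hl0 : 0 < 1 - ‖φ w‖ ^ 2 := by nlinarith [norm_nonneg (φ w)]
  have hw0 : 0 < 1 - ‖w‖ := by linarith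
  obtain ⟨hk, hkn⟩ := memHardy_szegoKernel hl
  obtain ⟨hWk, hWn⟩ := hC _ hk
  have h1 := hWk.norm_sq_le hw
  have h2 : (hardyNorm (weightedComp h φ (szegoKernel (φ w)))).toReal ≤
      C * (hardyNorm (szegoKernel (φ w))).toReal := by
    have := ENNReal.toReal_mono (ENNReal.mul_ne_top ENNReal.coe_ne_top hk.2.ne) hWn
    simpa using this
  -- At its own point the kernel has squared value `(1 - ‖φ w‖²)⁻²`, against a squared norm of at
  -- most `(1 - ‖φ w‖²)⁻¹`; the gained power is the factor in the conclusion.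
  have h3 : ‖weightedComp h φ (szegoKernel (φ w)) w‖ ^ 2 =
      ‖h w‖ ^ 2 * ((1 - ‖φ w‖ ^ 2)⁻¹) ^ 2 := by
    rw [weightedComp, szegoKernel, ← Complex.normSq_eq_conj_mul_self, Complex.normSq_eq_norm_sq,
      norm_mul, mul_pow, norm_inv]
    congr 3
    rw [← Complex.ofReal_one, ← Complex.ofReal_sub, Complex.norm_real, Real.norm_of_nonneg hl0.le]
  rw [h3] at h1
  have h4 : ‖h w‖ ^ 2 * ((1 - ‖φ w‖ ^ 2)⁻¹) ^ 2 ≤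
      4 / (1 - ‖w‖) * ((C : ℝ) ^ 2 * (1 - ‖φ w‖ ^ 2)⁻¹) := by
    refine h1.trans ?_
    gcongr
    calc _ ≤ (C * (hardyNorm (szegoKernel (φ w))).toReal) ^ 2 := by gcongr
      _ = (C : ℝ) ^ 2 * (hardyNorm (szegoKernel (φ w))).toReal ^ 2 := by ring
      _ ≤ _ := by gcongr
  calc ‖h w‖ ^ 2 = (‖h w‖ ^ 2 * ((1 - ‖φ w‖ ^ 2)⁻¹) ^ 2) * (1 - ‖φ w‖ ^ 2) ^ 2 := by
        field_simp
    _ ≤ (4 / (1 - ‖w‖) * ((C : ℝ) ^ 2 * (1 - ‖φ w‖ ^ 2)⁻¹)) * (1 - ‖φ w‖ ^ 2) ^ 2 := by gcongr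
    _ = _ := by field_simp

/-! ### Primitives up to the boundary -/

/-- The growth `|h(z)| ≤ C (1 - |z|)^(-1/2)` makes primitives of `h` uniformly Cauchy along
radii. -/
theorem norm_primitive_sub_le {h H : ℂ → ℂ} (hH : ∀ z ∈ Metric.ball (0 : ℂ) 1, HasDerivAt H (h z) z)
    {C : ℝ} (hC0 : 0 ≤ C) (hC : ∀ z : ℂ, ‖z‖ < 1 → ‖h z‖ ≤ C / √(1 - ‖z‖)) {z : ℂ} (hz : ‖z‖ ≤ 1)
    {s t : ℝ} (hs : 0 ≤ s) (hst : s ≤ t) (ht : t < 1) :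
    ‖H (t * z) - H (s * z)‖ ≤ 2 * C * √(1 - s) := by
  have hnorm : ∀ x : ℝ, s ≤ x → x ≤ t → ‖(x : ℂ) * z‖ ≤ x := by
    intro x hx1 hx2
    rw [norm_mul, Complex.norm_real, Real.norm_of_nonneg (hs.trans hx1)]
    exact mul_le_of_le_one_right (hs.trans hx1) hz
  have hder : ∀ x : ℝ, s ≤ x → x ≤ t →
      HasDerivAt (fun x : ℝ => H (x * z) - H (s * z)) (h (x * z) * z) x := by
    intro x hx1 hx2
    have h1 : HasDerivAt (fun x : ℂ => x * z) z (x : ℂ) := by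
      simpa using (hasDerivAt_id (x : ℂ)).mul_const z
    have h2 := (hH (x * z) (by
      rw [mem_ball_zero_iff]; exact ((hnorm x hx1 hx2).trans hx2).trans_lt ht)).comp (x : ℂ) h1
    exact (h2.comp_ofReal).sub_const _
  -- The majorant for the mean value inequality: the antiderivative of `C / √(1 - x)` vanishing at
  -- `s`.
  have hB : ∀ x : ℝ, s ≤ x → x ≤ t →
      HasDerivAt (fun x : ℝ => 2 * C * (√(1 - s) - √(1 - x))) (C / √(1 - x)) x := by
    intro x hx1 hx2
    have hx : 0 < 1 - x := by linarith
    have h1 : HasDerivAt (fun x : ℝ => √(1 - x)) (-1 / (2 * √(1 - x))) x :=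
      ((hasDerivAt_id x).const_sub 1).sqrt hx.ne'
    have h2 := (h1.const_sub (√(1 - s))).const_mul (2 * C)
    have h3 : √(1 - x) ≠ 0 := (Real.sqrt_pos.2 hx).ne'
    have h4 : C / √(1 - x) = 2 * C * -(-1 / (2 * √(1 - x))) := by field_simp
    rw [h4]
    exact h2
  have key := image_norm_le_of_norm_deriv_right_le_deriv_boundary' (a := s) (b := t)
    (f := fun x : ℝ => H (x * z) - H (s * z)) (f' := fun x : ℝ => h (x * z) * z)
    (fun x hx => (hder x hx.1 hx.2).continuousAt.continuousWithinAt)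
    (fun x hx => (hder x hx.1 hx.2.le).hasDerivWithinAt)
    (B := fun x : ℝ => 2 * C * (√(1 - s) - √(1 - x))) (B' := fun x => C / √(1 - x))
    (by simp) (fun x hx => (hB x hx.1 hx.2).continuousAt.continuousWithinAt)
    (fun x hx => (hB x hx.1 hx.2.le).hasDerivWithinAt) (by
      intro x hx
      have hx1 := hnorm x hx.1 hx.2.le
      have hx2 : x < 1 := hx.2.trans ht
      have h3 : 0 < √(1 - x) := Real.sqrt_pos.2 (by linarith)
      calc ‖h (x * z) * z‖ ≤ ‖h (x * z)‖ * 1 := by rw [norm_mul]; gcongr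
        _ ≤ C / √(1 - ‖(x : ℂ) * z‖) := by rw [mul_one]; exact hC _ (hx1.trans_lt hx2)
        _ ≤ C / √(1 - x) := by gcongr)
  have h5 := key (right_mem_Icc.2 hst)
  refine h5.trans ?_
  gcongr
  linarith [Real.sqrt_nonneg (1 - t)]

/-- The dilates `z ↦ H (ρ n * z)` of a primitive are continuous on the closed disc and uniformly
Cauchy there, by the previous estimate. Their limit is continuous and equals `H` inside. -/
theorem exists_primitive_continuousOn_closedBall {h : ℂ → ℂ}
    (hd : DifferentiableOn ℂ h (Metric.ball 0 1)) {C : ℝ} (hC0 : 0 ≤ C)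
    (hC : ∀ z : ℂ, ‖z‖ < 1 → ‖h z‖ ≤ C / √(1 - ‖z‖)) :
    ∃ G : ℂ → ℂ, ContinuousOn G (Metric.closedBall 0 1) ∧
      ∀ z ∈ Metric.ball (0 : ℂ) 1, HasDerivAt G (h z) z := by
  obtain ⟨H, hH⟩ := hd.isExactOn_ball
  set ρ : ℕ → ℝ := fun n => 1 - 1 / ((n : ℝ) + 1) with hρ
  have hρ0 : ∀ n, 0 ≤ ρ n := fun n => by
    have : 1 / ((n : ℝ) + 1) ≤ 1 := by
      rw [div_le_one (by positivity)]; linarith [Nat.cast_nonneg (α := ℝ) n]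
    simp only [hρ]; linarith
  have hρ1 : ∀ n, ρ n < 1 := fun n => by
    have : 0 < 1 / ((n : ℝ) + 1) := by positivity
    simp only [hρ]; linarith
  have hmono : Monotone ρ := fun m n hmn => by
    simp only [hρ]
    gcongr
  have hlim : Tendsto ρ atTop (𝓝 1) := by
    simpa [hρ] using (tendsto_one_div_add_atTop_nhds_zero_nat (𝕜 := ℝ)).const_sub 1
  have hcauchy : UniformCauchySeqOn (fun n z => H (ρ n * z)) atTop (Metric.closedBall 0 1) := by
    rw [Metric.uniformCauchySeqOn_iff]
    intro ε hε
    have h1 : Tendsto (fun n => 2 * C * √(1 - ρ n)) atTop (𝓝 0) := by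
      have := ((Real.continuous_sqrt.tendsto _).comp (hlim.const_sub 1)).const_mul (2 * C)
      simpa using this
    obtain ⟨N, hN⟩ := (h1.eventually_lt_const (half_pos hε)).exists
    have h2 : ∀ n ≥ N, ∀ z ∈ Metric.closedBall (0 : ℂ) 1,
        dist (H (ρ n * z)) (H (ρ N * z)) < ε / 2 := by
      intro n hn z hz
      rw [dist_eq_norm]
      exact (norm_primitive_sub_le hH hC0 hC (by simpa using hz) (hρ0 N) (hmono hn)
        (hρ1 n)).trans_lt hN
    refine ⟨N, fun m hm n hn z hz => ?_⟩
    have := dist_triangle_right (H (ρ m * z)) (H (ρ n * z)) (H (ρ N * z))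
    linarith [h2 m hm z hz, h2 n hn z hz]
  have hex : ∀ z, ∃ g, z ∈ Metric.closedBall (0 : ℂ) 1 →
      Tendsto (fun n => H (ρ n * z)) atTop (𝓝 g) := by
    intro z
    by_cases hz : z ∈ Metric.closedBall (0 : ℂ) 1
    · obtain ⟨g, hg⟩ := cauchySeq_tendsto_of_complete (hcauchy.cauchySeq hz)
      exact ⟨g, fun _ => hg⟩
    · exact ⟨0, fun h => absurd h hz⟩
  choose G hG using hex
  have hunif := hcauchy.tendstoUniformlyOn_of_tendsto fun z hz => hG z hz
  have hmem : ∀ n, ∀ z ∈ Metric.closedBall (0 : ℂ) 1, (ρ n : ℂ) * z ∈ Metric.ball (0 : ℂ) 1 := by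
    intro n z hz
    rw [mem_closedBall_zero_iff] at hz
    rw [mem_ball_zero_iff, norm_mul, Complex.norm_real, Real.norm_of_nonneg (hρ0 n)]
    exact (mul_le_of_le_one_right (hρ0 n) hz).trans_lt (hρ1 n)
  have hHc : ContinuousOn H (Metric.ball 0 1) := fun z hz => (hH z hz).continuousAt.continuousWithinAt
  refine ⟨G, hunif.continuousOn (Frequently.of_forall fun n => ?_), fun z hz => ?_⟩
  · exact hHc.comp (by fun_prop) (hmem n)
  · have heq : ∀ z ∈ Metric.ball (0 : ℂ) 1, G z = H z := by
      intro z hz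
      refine tendsto_nhds_unique (hG z (Metric.ball_subset_closedBall hz)) ?_
      have h1 : Tendsto (fun n => (ρ n : ℂ) * z) atTop (𝓝 z) := by
        have h2 := ((Complex.continuous_ofReal.tendsto 1).comp hlim).mul_const z
        simpa using h2
      exact (hH z hz).continuousAt.tendsto.comp h1
    refine (hH z hz).congr_of_eventuallyEq ?_
    filter_upwards [Metric.isOpen_ball.mem_nhds hz] with x hx using heq x hx

/-- The intersection of two balls is convex, so the mean value inequality applies inside. Boundary
points are reached along `t * z` with `t → 1⁻`, by continuity of `G`. -/
theorem lipschitzOnWith_primitive {h G : ℂ → ℂ} (hGc : ContinuousOn G (Metric.closedBall 0 1))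
    (hG : ∀ z ∈ Metric.ball (0 : ℂ) 1, HasDerivAt G (h z) z) {p : ℂ} {δ : ℝ} {C : ℝ≥0}
    (hC : ∀ z ∈ Metric.ball (0 : ℂ) 1 ∩ Metric.ball p δ, ‖h z‖ ≤ C) :
    LipschitzOnWith C G (Metric.closedBall 0 1 ∩ Metric.ball p δ) := by
  have hlip : LipschitzOnWith C G (Metric.ball 0 1 ∩ Metric.ball p δ) :=
    ((convex_ball 0 1).inter (convex_ball p δ)).lipschitzOnWith_of_nnnorm_hasDerivWithin_le
      (fun z hz => (hG z hz.1).hasDerivWithinAt) hC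
  have hray : ∀ z ∈ Metric.closedBall (0 : ℂ) 1 ∩ Metric.ball p δ,
      Tendsto (fun t : ℝ => (t : ℂ) * z) (𝓝[<] 1)
        (𝓝[Metric.ball 0 1 ∩ Metric.ball p δ] z) := by
    intro z hz
    have h1 : Tendsto (fun t : ℝ => (t : ℂ) * z) (𝓝[<] 1) (𝓝 z) := by
      have h2 := ((Complex.continuous_ofReal.tendsto 1).mul_const z).mono_left
        (nhdsWithin_le_nhds (s := Iio (1 : ℝ)))
      simpa using h2
    refine tendsto_nhdsWithin_iff.2 ⟨h1, ?_⟩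
    have h3 : ∀ᶠ t : ℝ in 𝓝[<] 1, 0 < t :=
      nhdsWithin_le_nhds (Ioi_mem_nhds zero_lt_one)
    filter_upwards [h1 (Metric.isOpen_ball.mem_nhds hz.2), h3, self_mem_nhdsWithin] with t ht ht0 ht1
    refine ⟨?_, ht⟩
    have h4 := mem_closedBall_zero_iff.1 hz.1
    rw [mem_ball_zero_iff, norm_mul, Complex.norm_real, Real.norm_of_nonneg ht0.le]
    exact (mul_le_of_le_one_right ht0.le h4).trans_lt ht1
  have hGray : ∀ z ∈ Metric.closedBall (0 : ℂ) 1 ∩ Metric.ball p δ,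
      Tendsto (fun t : ℝ => G ((t : ℂ) * z)) (𝓝[<] 1) (𝓝 (G z)) := fun z hz =>
    (hGc z hz.1).tendsto.comp ((hray z hz).mono_right
      (nhdsWithin_mono z (inter_subset_left.trans Metric.ball_subset_closedBall)))
  refine LipschitzOnWith.of_dist_le_mul fun z hz w hw => ?_
  have h1 := (hGray z hz).dist (hGray w hw)
  have h2 := ((((hray z hz).mono_right nhdsWithin_le_nhds).dist
    ((hray w hw).mono_right nhdsWithin_le_nhds)).const_mul (C : ℝ))
  refine le_of_tendsto_of_tendsto h1 h2 ?_
  filter_upwards [(tendsto_nhdsWithin_iff.1 (hray z hz)).2,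
    (tendsto_nhdsWithin_iff.1 (hray w hw)).2] with t ht1 ht2
  exact hlip.dist_le_mul _ ht1 _ ht2

/-! ### The local Fatou theorem -/

theorem ae_arcMeasure_of_ae_exp {P : Circle → Prop} (h : ∀ᵐ θ : ℝ, P (Circle.exp θ)) :
    ∀ᵐ ζ ∂arcMeasure, P ζ := by
  have hs : MeasurableSet (Ioc 0 (2 * Real.pi)) := measurableSet_Ioc
  have hinj : InjOn Circle.exp (Ioc 0 (2 * Real.pi)) := by
    intro x hx y hy hxy
    obtain ⟨m, hm⟩ := Circle.exp_eq_exp.1 hxy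
    have hpi := Real.pi_pos
    have h1 : (m : ℝ) < 1 := by
      by_contra hge
      nlinarith [hx.1, hx.2, hy.1, hy.2]
    have h2 : (-1 : ℝ) < m := by
      by_contra hge
      nlinarith [hx.1, hx.2, hy.1, hy.2]
    have h3 : m = 0 := by
      have h1' : m < 1 := by exact_mod_cast h1
      have h2' : -1 < m := by exact_mod_cast h2
      omega
    simpa [h3] using hm
  -- Injectivity on one period makes the parametrisation a measurable embedding, so null sets
  -- transfer without measurability of `P`.
  have hemb := ContinuousOn.measurableEmbedding hs (Circle.exp).continuous.continuousOn hinj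
  have hmap : Measure.map Circle.exp (volume.restrict (Ioc 0 (2 * Real.pi))) =
      Measure.map ((Ioc 0 (2 * Real.pi)).domRestrict Circle.exp)
        (Measure.comap Subtype.val volume) := by
    rw [← map_comap_subtype_coe hs, Measure.map_map (Circle.exp).continuous.measurable
      measurable_subtype_coe]
    rfl
  refine Measure.ae_smul_measure ?_ _
  rw [hmap, hemb.ae_map_iff]
  have h1 : ∀ᵐ θ ∂(volume.restrict (Ioc 0 (2 * Real.pi))), P (Circle.exp θ) :=
    ae_restrict_of_ae h
  rw [← map_comap_subtype_coe hs, (MeasurableEmbedding.subtype_coe hs).ae_map_iff] at h1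
  exact h1

open Asymptotics in
/-- Differentiability of `θ ↦ G(e^{iθ})` gives a first order expansion of `G` along the circle. -/
theorem isLittleO_circle_of_hasDerivAt {G : ℂ → ℂ} {θ₀ : ℝ} {D : ℂ}
    (hD : HasDerivAt (fun θ : ℝ => G (Circle.exp θ)) D θ₀) :
    (fun ζ : ℂ => G ζ - G (Circle.exp θ₀) -
        (-Complex.I * D / (Circle.exp θ₀ : ℂ)) * (ζ - Circle.exp θ₀))
      =o[𝓝[Metric.sphere 0 1] (Circle.exp θ₀ : ℂ)] fun ζ => ζ - Circle.exp θ₀ := by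
  set ζ₀ : ℂ := (Circle.exp θ₀ : ℂ) with hζ₀
  have hne : ζ₀ ≠ 0 := Circle.coe_ne_zero _
  have hlog : HasDerivAt (fun ζ : ℂ => Complex.log (ζ / ζ₀)) (1 / ζ₀) ζ₀ := by
    have h1 : HasDerivAt (fun ζ : ℂ => ζ / ζ₀) (1 / ζ₀) ζ₀ := (hasDerivAt_id ζ₀).div_const ζ₀
    have h2 := h1.clog (by rw [div_self hne]; exact Complex.one_mem_slitPlane)
    simpa [div_self hne] using h2
  have h1 : (fun ζ : ℂ => Complex.log (ζ / ζ₀) - (ζ - ζ₀) * (1 / ζ₀)) =o[𝓝 ζ₀]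
      fun ζ => ζ - ζ₀ := by
    simpa [div_self hne, smul_eq_mul] using hlog.isLittleO
  have hO : (fun ζ : ℂ => Complex.log (ζ / ζ₀)) =O[𝓝 ζ₀] fun ζ => ζ - ζ₀ := by
    simpa [div_self hne] using hlog.isBigO_sub
  -- `L ζ` is the angle from `ζ₀` to `ζ`. On the circle `log (ζ / ζ₀) = i L ζ`, so the expansion in
  -- the angle becomes one in `ζ - ζ₀`, with coefficient `D / (i ζ₀)`.
  set L : ℂ → ℝ := fun ζ => (Complex.log (ζ / ζ₀)).im with hL
  have hLO : L =O[𝓝 ζ₀] fun ζ => ζ - ζ₀ :=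
    (IsBigO.of_norm_le fun ζ => Complex.abs_im_le_norm _).trans hO.norm_left
  have hLt : Tendsto L (𝓝 ζ₀) (𝓝 0) := by
    refine hLO.trans_tendsto ?_
    have : Tendsto (fun ζ : ℂ => ζ - ζ₀) (𝓝 ζ₀) (𝓝 (ζ₀ - ζ₀)) := tendsto_id.sub_const ζ₀
    rwa [sub_self] at this
  have h2 : (fun t : ℝ => G (Circle.exp (θ₀ + t)) - G (Circle.exp θ₀) - t • D) =o[𝓝 0]
      fun t => t := hasDerivAt_iff_isLittleO_nhds_zero.1 hD
  have h3 : (fun ζ : ℂ => G (Circle.exp (θ₀ + L ζ)) - G ζ₀ - L ζ • D) =o[𝓝 ζ₀]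
      fun ζ => ζ - ζ₀ := (h2.comp_tendsto hLt).trans_isBigO hLO
  have h4 := (h3.add (h1.const_mul_left (-Complex.I * D))).mono
    (nhdsWithin_le_nhds (s := Metric.sphere (0 : ℂ) 1))
  refine h4.congr' ?_ EventuallyEq.rfl
  filter_upwards [self_mem_nhdsWithin] with ζ hζ
  have hζ1 : ‖ζ / ζ₀‖ = 1 := by
    rw [norm_div, hζ₀, Circle.norm_coe, div_one]
    simpa using hζ
  have hq0 : ζ / ζ₀ ≠ 0 := by
    intro h0
    simp [h0] at hζ1
  have hlogL : Complex.log (ζ / ζ₀) = L ζ * Complex.I := by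
    apply Complex.ext
    · rw [Complex.log_re, hζ1]; simp
    · simp [hL]
  have hexp : (Circle.exp (θ₀ + L ζ) : ℂ) = ζ := by
    rw [Circle.exp_add, Circle.coe_mul, Circle.coe_exp (L ζ), ← hlogL, Complex.exp_log hq0, ← hζ₀]
    field_simp
  rw [hexp, hlogL, Complex.real_smul]
  linear_combination (-D * L ζ) * Complex.I_sq

theorem norm_sub_le_norm_sub_smul {ζ₀ ζ : ℂ} (h₀ : ‖ζ₀‖ = 1) (h : ‖ζ‖ = 1) {r : ℝ} (hr0 : 0 ≤ r)
    (hr1 : r < 1) : ‖ζ - ζ₀‖ ≤ 2 * ‖ζ - r * ζ₀‖ ∧ 0 < ‖ζ - r * ζ₀‖ := by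
  have h1 : ‖(r : ℂ) * ζ₀‖ = r := by
    rw [norm_mul, Complex.norm_real, Real.norm_of_nonneg hr0, h₀, mul_one]
  have h2 : 1 - r ≤ ‖ζ - r * ζ₀‖ := by
    have := norm_sub_norm_le ζ (r * ζ₀)
    rwa [h1, h] at this
  have h3 : ‖(r : ℂ) * ζ₀ - ζ₀‖ = 1 - r := by
    have : (r : ℂ) * ζ₀ - ζ₀ = ((r - 1 : ℝ) : ℂ) * ζ₀ := by push_cast; ring
    rw [this, norm_mul, Complex.norm_real, h₀, mul_one, Real.norm_of_nonpos (by linarith)]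
    ring
  have h4 := norm_sub_le_norm_sub_add_norm_sub ζ (r * ζ₀) ζ₀
  constructor <;> linarith

/-- Makes the two squared factors in the denominator of the kernel below equal in modulus on the
circle. -/
theorem norm_sub_smul_eq {ζ₀ ζ : ℂ} (h₀ : ‖ζ₀‖ = 1) (h : ‖ζ‖ = 1) (r : ℝ) :
    ‖ζ₀ - r * ζ‖ = ‖ζ - r * ζ₀‖ := by
  rw [← sq_eq_sq₀ (norm_nonneg _) (norm_nonneg _)]
  have h1 : ζ₀.re * ζ₀.re + ζ₀.im * ζ₀.im = 1 := by
    rw [← Complex.normSq_apply, Complex.normSq_eq_norm_sq, h₀]; norm_num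
  have h2 : ζ.re * ζ.re + ζ.im * ζ.im = 1 := by
    rw [← Complex.normSq_apply, Complex.normSq_eq_norm_sq, h]; norm_num
  simp only [← Complex.normSq_eq_norm_sq, Complex.normSq_apply, Complex.sub_re, Complex.sub_im,
    Complex.mul_re, Complex.mul_im, Complex.ofReal_re, Complex.ofReal_im]
  linear_combination (1 - r ^ 2) * h1 - (1 - r ^ 2) * h2

/-- The derivative at `r ζ₀` as an average of the boundary values against a kernel that vanishes
at `±ζ₀`. -/
theorem deriv_eq_circleAverage {g : ℂ → ℂ} (hgc : ContinuousOn g (Metric.closedBall 0 1))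
    (hg : DifferentiableOn ℂ g (Metric.ball 0 1)) {ζ₀ : ℂ} (h₀ : ‖ζ₀‖ = 1) {r : ℝ} (hr0 : 0 ≤ r)
    (hr1 : r < 1) :
    deriv g (r * ζ₀) = Real.circleAverage
      (fun ζ => ζ * (((1 - r ^ 2) * (ζ₀ - ζ) * (ζ₀ + ζ)) /
        ((ζ - r * ζ₀) ^ 2 * (ζ₀ - r * ζ) ^ 2) * g ζ)) 0 1 := by
  set z : ℂ := r * ζ₀ with hz
  have hzn : ‖z‖ = r := by
    rw [hz, norm_mul, Complex.norm_real, Real.norm_of_nonneg hr0, h₀, mul_one]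
  have hzb : z ∈ Metric.ball (0 : ℂ) 1 := by simpa [hzn] using hr1
  have hden : ∀ ζ ∈ Metric.closedBall (0 : ℂ) 1, ζ₀ - r * ζ ≠ 0 := by
    intro ζ hζ h
    have h1 : ‖(r : ℂ) * ζ‖ = 1 := by rw [← sub_eq_zero.1 h, h₀]
    rw [norm_mul, Complex.norm_real, Real.norm_of_nonneg hr0] at h1
    have h2 : ‖ζ‖ ≤ 1 := by simpa using hζ
    nlinarith [norm_nonneg ζ]
  have hnhds : Metric.closedBall (0 : ℂ) 1 ∈ 𝓝 z :=
    mem_of_superset (Metric.isOpen_ball.mem_nhds hzb) Metric.ball_subset_closedBall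
  have hgz : DifferentiableAt ℂ g z := hg.differentiableAt (Metric.isOpen_ball.mem_nhds hzb)
  -- The subtracted term vanishes at `z`, so Cauchy's formula still returns `g' z`, while the kernel
  -- becomes `(ζ - z)⁻² - (ζ₀ - r ζ)⁻²`, which is zero at `ζ = ±ζ₀`. Without the zero at `ζ₀`, a
  -- bound `‖g ζ‖ ≤ ε ‖ζ - ζ₀‖` would leave a logarithmic divergence as `r → 1`.
  set F : ℂ → ℂ := fun ζ => dslope g z ζ - (ζ - z) * (g ζ / (ζ₀ - r * ζ) ^ 2) with hF
  have hquot : DiffContOnCl ℂ F (Metric.ball 0 1) := by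
    refine ⟨?_, ?_⟩
    · refine ((Complex.differentiableOn_dslope (Metric.isOpen_ball.mem_nhds hzb)).2 hg).sub ?_
      refine DifferentiableOn.mul (by fun_prop) (hg.div (by fun_prop) fun ζ hζ => ?_)
      exact pow_ne_zero 2 (hden ζ (Metric.ball_subset_closedBall hζ))
    · rw [closure_ball _ one_ne_zero]
      refine ((continuousOn_dslope hnhds).2 ⟨hgc, hgz⟩).sub ?_
      refine ContinuousOn.mul (by fun_prop) (hgc.div (by fun_prop) fun ζ hζ => ?_)
      exact pow_ne_zero 2 (hden ζ hζ)
  have hC := hquot.circleIntegral_sub_inv_smul hzb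
  have hFz : F z = deriv g z := by simp [hF]
  rw [hFz] at hC
  set k : ℂ → ℂ := fun ζ => ((1 - r ^ 2) * (ζ₀ - ζ) * (ζ₀ + ζ)) /
        ((ζ - z) ^ 2 * (ζ₀ - r * ζ) ^ 2) * g ζ with hk
  have hne : ∀ ζ ∈ Metric.sphere (0 : ℂ) 1, ζ - z ≠ 0 := by
    intro ζ hζ h
    have h1 : ‖ζ‖ = 1 := by simpa using hζ
    rw [sub_eq_zero.1 h, hzn] at h1
    linarith
  have hkint : CircleIntegrable k 0 1 := by
    apply ContinuousOn.circleIntegrable zero_le_one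
    refine ContinuousOn.mul (ContinuousOn.div (by fun_prop) (by fun_prop) fun ζ hζ => ?_)
      (hgc.mono Metric.sphere_subset_closedBall)
    exact mul_ne_zero (pow_ne_zero 2 (hne ζ hζ))
      (pow_ne_zero 2 (hden ζ (Metric.sphere_subset_closedBall hζ)))
  have hcint : CircleIntegrable (fun ζ => g z * (ζ - z) ^ (-2 : ℤ)) 0 1 := by
    apply ContinuousOn.circleIntegrable zero_le_one
    refine ContinuousOn.mul continuousOn_const (ContinuousOn.zpow₀ (by fun_prop) _ fun ζ hζ => ?_)
    exact Or.inl (hne ζ hζ)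
  -- The constant `g z` in the difference quotient contributes nothing.
  have hzero : ∮ ζ in C(0, 1), g z * (ζ - z) ^ (-2 : ℤ) = 0 := by
    have := circleIntegral.integral_sub_zpow_of_ne (n := -2) (by norm_num) (0 : ℂ) z 1
    rw [circleIntegral.integral_const_mul, this, mul_zero]
  have hsplit : ∮ ζ in C(0, 1), (ζ - z)⁻¹ • F ζ =
      ∮ ζ in C(0, 1), (k ζ - g z * (ζ - z) ^ (-2 : ℤ)) := by
    refine circleIntegral.integral_congr zero_le_one fun ζ hζ => ?_
    have h1 := hne ζ hζ
    have h2 := hden ζ (Metric.sphere_subset_closedBall hζ)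
    have h3 : ζ ≠ z := sub_ne_zero.1 h1
    have h4 : ((1 : ℂ) - r ^ 2) * (ζ₀ - ζ) * (ζ₀ + ζ) = (ζ₀ - r * ζ) ^ 2 - (ζ - z) ^ 2 := by
      rw [hz]; ring
    simp only [hF, hk, dslope_of_ne g h3, slope_def_field, smul_eq_mul, h4]
    rw [zpow_neg, zpow_ofNat]
    generalize ζ₀ - r * ζ = q at h2 ⊢
    field_simp
    ring
  rw [hsplit, circleIntegral.integral_sub hkint hcint, hzero, sub_zero] at hC
  rw [Real.circleAverage_eq_circleIntegral one_ne_zero]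
  have h5 : ∮ ζ in C(0, 1), (ζ - 0)⁻¹ • (ζ * k ζ) = ∮ ζ in C(0, 1), k ζ := by
    refine circleIntegral.integral_congr zero_le_one fun ζ hζ => ?_
    have h6 : ζ ≠ 0 := by
      rintro rfl
      simp at hζ
    simp only [sub_zero, smul_eq_mul]
    field_simp
  rw [h5, hC, smul_smul, inv_mul_cancel₀ Complex.two_pi_I_ne_zero, one_smul]

/-- Where a primitive `G` of `h` has a first order expansion along the circle, `h` has a radial
limit. -/
theorem tendsto_radial_of_isLittleO {h G : ℂ → ℂ} (hGc : ContinuousOn G (Metric.closedBall 0 1))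
    (hG : ∀ z ∈ Metric.ball (0 : ℂ) 1, HasDerivAt G (h z) z) {ζ₀ A : ℂ} (h₀ : ‖ζ₀‖ = 1)
    (hA : (fun ζ : ℂ => G ζ - G ζ₀ - A * (ζ - ζ₀)) =o[𝓝[Metric.sphere 0 1] ζ₀] fun ζ => ζ - ζ₀) :
    Tendsto (fun r : ℝ => h (r * ζ₀)) (𝓝[<] 1) (𝓝 A) := by
  set g : ℂ → ℂ := fun ζ => G ζ - G ζ₀ - A * (ζ - ζ₀) with hg
  have hgc : ContinuousOn g (Metric.closedBall 0 1) :=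
    (hGc.sub continuousOn_const).sub (by fun_prop)
  have hgd : ∀ z ∈ Metric.ball (0 : ℂ) 1, HasDerivAt g (h z - A) z := by
    intro z hz
    have h1 : HasDerivAt (fun ζ : ℂ => A * (ζ - ζ₀)) A z := by
      simpa using ((hasDerivAt_id z).sub_const ζ₀).const_mul A
    exact ((hG z hz).sub_const _).sub h1
  obtain ⟨M, hM⟩ := (isCompact_closedBall (0 : ℂ) 1).exists_bound_of_continuousOn hgc
  have hM0 : 0 ≤ M := (norm_nonneg _).trans (hM 0 (by simp))
  have hbound : ∀ ε : ℝ, 0 < ε → ∃ T : ℝ, ∀ r : ℝ, 0 ≤ r → r < 1 →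
      ‖h (r * ζ₀) - A‖ ≤ 8 * ε + (1 - r ^ 2) * T := by
    intro ε hε
    obtain ⟨η, hη, hball⟩ := Metric.mem_nhdsWithin_iff.1 (hA.def hε)
    -- Off the `η`-arc, `‖ζ - ζ₀‖` and `‖ζ + ζ₀‖` are at most `2` and `‖ζ - r ζ₀‖ ≥ η / 2`: `2 · 2 ·
    -- (2 / η)⁴ = 64 / η⁴`.
    refine ⟨64 * M / η ^ 4, fun r hr0 hr1 => ?_⟩
    have hr2 : 0 ≤ 1 - r ^ 2 := by nlinarith
    have hzn : ‖(r : ℂ) * ζ₀‖ = r := by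
      rw [norm_mul, Complex.norm_real, Real.norm_of_nonneg hr0, h₀, mul_one]
    have hzb : (r : ℂ) * ζ₀ ∈ Metric.ball (0 : ℂ) 1 := by
      rwa [mem_ball_zero_iff, hzn]
    have hne : ∀ ζ ∈ Metric.sphere (0 : ℂ) 1, ζ - r * ζ₀ ≠ 0 := fun ζ hζ =>
      norm_pos_iff.1 (norm_sub_le_norm_sub_smul h₀ (by simpa using hζ) hr0 hr1).2
    have hPint : CircleIntegrable (poissonKernel 0 (r * ζ₀)) 0 1 := by
      apply ContinuousOn.circleIntegrable zero_le_one
      simp only [funext (poissonKernel_def 0 (r * ζ₀)), sub_zero]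
      refine ContinuousOn.div (by fun_prop) (by fun_prop) fun ζ hζ => ?_
      exact pow_ne_zero 2 (norm_ne_zero_iff.2 (hne ζ hζ))
    have hPint' : CircleIntegrable (fun ζ => (8 * ε) • poissonKernel 0 (r * ζ₀) ζ) 0 1 :=
      hPint.const_smul
    have hcint : CircleIntegrable (fun _ : ℂ => (1 - r ^ 2) * (64 * M / η ^ 4)) 0 1 :=
      circleIntegrable_const _ _ _
    rw [← (hgd _ hzb).deriv, deriv_eq_circleAverage hgc
      (fun z hz => (hgd z hz).differentiableAt.differentiableWithinAt) h₀ hr0 hr1]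
    refine (norm_circleAverage_le (hPint'.add hcint) fun ζ hζ => ?_).trans ?_
    · rw [abs_one] at hζ
      have hζ1 : ‖ζ‖ = 1 := by simpa using hζ
      obtain ⟨h1, h2⟩ := norm_sub_le_norm_sub_smul h₀ hζ1 hr0 hr1
      have h3 : ‖ζ₀ + ζ‖ ≤ 2 := (norm_add_le _ _).trans (by rw [h₀, hζ1]; norm_num)
      have h4 : ‖(1 : ℂ) - r ^ 2‖ = 1 - r ^ 2 := by
        rw [← Complex.ofReal_one, ← Complex.ofReal_pow, ← Complex.ofReal_sub, Complex.norm_real,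
          Real.norm_of_nonneg hr2]
      simp only [norm_mul, norm_div, norm_pow, hζ1, one_mul, h4, norm_sub_smul_eq h₀ hζ1 r,
        Pi.add_apply, smul_eq_mul, poissonKernel_def, sub_zero, hzn, one_pow]
      rw [norm_sub_rev ζ₀ ζ]
      set d := ‖ζ - r * ζ₀‖ with hd
      set e := ‖ζ - ζ₀‖ with he
      have he0 : 0 ≤ e := norm_nonneg _
      -- Near `ζ₀`, the zero of the kernel and the smallness of `g` give `e²`, absorbed by `e ≤ 2d`,
      -- leaving `8ε` times the Poisson kernel. Far away the factor `1 - r²` makes the contribution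
      -- vanish in the limit.
      by_cases hlt : e < η
      · have h5 : ‖g ζ‖ ≤ ε * e := hball ⟨mem_ball_iff_norm.2 hlt, hζ⟩
        have h6 : (1 - r ^ 2) * e * ‖ζ₀ + ζ‖ / (d ^ 2 * d ^ 2) * ‖g ζ‖ ≤
            8 * ε * ((1 - r ^ 2) / d ^ 2) := by
          calc _ ≤ (1 - r ^ 2) * e * 2 / (d ^ 2 * d ^ 2) * (ε * e) := by gcongr
            _ = 2 * ε * ((1 - r ^ 2) / (d ^ 2 * d ^ 2)) * e ^ 2 := by ring
            _ ≤ 2 * ε * ((1 - r ^ 2) / (d ^ 2 * d ^ 2)) * (2 * d) ^ 2 := by gcongr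
            _ = _ := by field_simp; ring
        have h7 : 0 ≤ (1 - r ^ 2) * (64 * M / η ^ 4) := by positivity
        linarith
      · have h5 : ‖g ζ‖ ≤ M := hM ζ (Metric.sphere_subset_closedBall hζ)
        have h8 : e ≤ 2 := (norm_sub_le _ _).trans (by rw [h₀, hζ1]; norm_num)
        have h9 : η / 2 ≤ d := by linarith [not_lt.1 hlt]
        have h6 : (1 - r ^ 2) * e * ‖ζ₀ + ζ‖ / (d ^ 2 * d ^ 2) * ‖g ζ‖ ≤
            (1 - r ^ 2) * (64 * M / η ^ 4) := by
          calc _ ≤ (1 - r ^ 2) * 2 * 2 / ((η / 2) ^ 2 * (η / 2) ^ 2) * M := by gcongr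
            _ = _ := by field_simp; ring
        have h7 : 0 ≤ 8 * ε * ((1 - r ^ 2) / d ^ 2) := by positivity
        linarith
    · rw [Real.circleAverage_add hPint' hcint, Real.circleAverage_fun_smul,
        Real.circleAverage_const]
      have h6 : Real.circleAverage (fun z => poissonKernel 0 (r * ζ₀) z) 0 1 = 1 :=
        circleAverage_poissonKernel (by rw [hzn]; exact hr1)
      rw [h6, smul_eq_mul, mul_one]
  rw [tendsto_iff_norm_sub_tendsto_zero]
  refine (NormedAddGroup.tendsto_nhds_zero (f := fun r : ℝ => ‖h (r * ζ₀) - A‖)).2 fun ε hε => ?_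
  obtain ⟨T, hT⟩ := hbound (ε / 16) (by positivity)
  have hlim : Tendsto (fun r : ℝ => 8 * (ε / 16) + (1 - r ^ 2) * T) (𝓝[<] 1)
      (𝓝 (8 * (ε / 16) + (1 - 1 ^ 2) * T)) :=
    (Continuous.tendsto (by fun_prop) 1).mono_left nhdsWithin_le_nhds
  have hpos : ∀ᶠ r : ℝ in 𝓝[<] 1, 0 < r := nhdsWithin_le_nhds (Ioi_mem_nhds zero_lt_one)
  filter_upwards [hlim.eventually_lt_const (show _ < ε by linarith), hpos, self_mem_nhdsWithin]
    with r hr hr0 hr1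
  rw [norm_norm]
  exact (hT r hr0.le hr1).trans_lt hr

/-- A local Fatou theorem: an analytic function of growth `(1 - |z|)^(-1/2)` that is bounded near
a subset of the circle has radial limits at almost every point of it. -/
theorem ae_hasRadialLimit {h : ℂ → ℂ} (hd : DifferentiableOn ℂ h (Metric.ball 0 1)) {C : ℝ}
    (hC0 : 0 ≤ C) (hC : ∀ z : ℂ, ‖z‖ < 1 → ‖h z‖ ≤ C / √(1 - ‖z‖)) {S : Set Circle} {δ : ℝ}
    (hδ : 0 < δ) {B : ℝ≥0}
    (hB : ∀ p ∈ S, ∀ z ∈ Metric.ball (0 : ℂ) 1 ∩ Metric.ball (p : ℂ) δ, ‖h z‖ ≤ B) :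
    ∀ᵐ ζ ∂arcMeasure, ζ ∈ S → ∃ w : ℂ, HasRadialLimit h ζ w ∧ ‖w‖ ≤ B := by
  obtain ⟨G, hGc, hG⟩ := exists_primitive_continuousOn_closedBall hd hC0 hC
  set F : ℝ → ℂ := fun θ => G (Circle.exp θ) with hF
  have hdiff : ∀ᵐ θ : ℝ, Circle.exp θ ∈ S → DifferentiableAt ℝ F θ := by
    rw [ae_iff]
    -- Only a neighbourhood of each exceptional angle matters; there `F` is Lipschitz, hence
    -- differentiable almost everywhere. `S` need not be measurable.
    refine measure_null_of_locally_null _ fun θ₀ hθ₀ => ?_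
    obtain ⟨hS, -⟩ := Classical.not_imp.1 hθ₀
    have hexp : LipschitzWith 1 fun θ : ℝ => (Circle.exp θ : ℂ) := by
      refine lipschitzWith_of_nnnorm_deriv_le (𝕜 := ℝ) ?_ ?_
      · simp only [Circle.coe_exp]
        fun_prop
      · intro θ
        have h1 : HasDerivAt (fun θ : ℝ => (Circle.exp θ : ℂ))
            (Complex.exp (θ * Complex.I) * Complex.I) θ := by
          simp only [Circle.coe_exp]
          have h2 : HasDerivAt (fun z : ℂ => Complex.exp (z * Complex.I))
              (Complex.exp (θ * Complex.I) * Complex.I) (θ : ℂ) := by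
            simpa using ((hasDerivAt_id (θ : ℂ)).mul_const Complex.I).cexp
          exact h2.comp_ofReal
        rw [h1.deriv, ← NNReal.coe_le_coe, coe_nnnorm, norm_mul, Complex.norm_exp_ofReal_mul_I]
        simp
    have hmaps : MapsTo (fun θ : ℝ => (Circle.exp θ : ℂ)) (Metric.ball θ₀ δ)
        (Metric.closedBall 0 1 ∩ Metric.ball (Circle.exp θ₀ : ℂ) δ) := by
      intro θ hθ
      refine ⟨by rw [mem_closedBall_zero_iff, Circle.norm_coe], ?_⟩
      have := hexp.dist_le_mul θ θ₀
      rw [NNReal.coe_one, one_mul] at this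
      exact this.trans_lt hθ
    have hlip : LipschitzOnWith (B * 1) F (Metric.ball θ₀ δ) :=
      (lipschitzOnWith_primitive hGc hG (hB _ hS)).comp hexp.lipschitzOnWith hmaps
    refine ⟨_, inter_mem_nhdsWithin _ (Metric.ball_mem_nhds θ₀ hδ), ?_⟩
    refine measure_mono_null ?_ (ae_iff.1 hlip.ae_differentiableWithinAt_of_mem_real)
    rintro θ ⟨hθ1, hθ2⟩ hθ3
    exact hθ1 fun _ => (hθ3 hθ2).differentiableAt (Metric.isOpen_ball.mem_nhds hθ2)
  refine ae_arcMeasure_of_ae_exp ?_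
  filter_upwards [hdiff] with θ hθ hS
  have hlim := tendsto_radial_of_isLittleO hGc hG (Circle.norm_coe _)
    (isLittleO_circle_of_hasDerivAt (hθ hS).hasDerivAt)
  refine ⟨_, hlim, le_of_tendsto hlim.norm ?_⟩
  have h1 : Tendsto (fun t : ℝ => (t : ℂ) * Circle.exp θ) (𝓝[<] 1) (𝓝 (Circle.exp θ : ℂ)) := by
    have h2 := ((Complex.continuous_ofReal.tendsto 1).mul_const (Circle.exp θ : ℂ)).mono_left
      (nhdsWithin_le_nhds (s := Iio (1 : ℝ)))
    simpa using h2
  have hpos : ∀ᶠ r : ℝ in 𝓝[<] 1, 0 < r := nhdsWithin_le_nhds (Ioi_mem_nhds zero_lt_one)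
  filter_upwards [h1 (Metric.ball_mem_nhds _ hδ), hpos, self_mem_nhdsWithin] with r hr hr0 hr1
  refine hB _ hS _ ⟨?_, hr⟩
  rw [mem_ball_zero_iff, norm_mul, Circle.norm_coe, mul_one, Complex.norm_real,
    Real.norm_of_nonneg hr0.le]
  exact hr1

/-! ### Essential boundedness off the spectrum -/

theorem IsCanonicalRep.essBoundedOn {ι : Type*} {φ : ℂ → ℂ} {α : ℝ} {N : ℕ} {a : ι → ℂ}
    {μ : Measure Circle} (hrep : IsCanonicalRep φ α N a μ)
    (hself : MapsTo φ (Metric.ball 0 1) (Metric.ball 0 1)) {h : ℂ → ℂ}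
    (hh : h ∈ multiplierSpace φ) {K : Set Circle} (hK : IsCompact (closure K))
    (hKσ : closure K ⊆ {ζ : Circle | (ζ : ℂ) ∉ innerSpectrum a μ}) : EssBoundedOn h K := by
  obtain ⟨δ, hδ, hthick⟩ := (hK.image (f := fun ζ : Circle => (ζ : ℂ))
    (by fun_prop)).exists_thickening_subset_open
    (isClosed_innerSpectrum (a := a) (μ := μ)).isOpen_compl (by
      rintro _ ⟨ζ, hζ, rfl⟩
      exact hKσ hζ)
  have hdist : ∀ ζ ∈ closure K, ∀ x ∈ innerSpectrum a μ, δ ≤ ‖x - ζ‖ := by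
    intro ζ hζ x hx
    by_contra hlt
    exact hthick (Metric.mem_thickening_iff.2 ⟨ζ, ⟨ζ, hζ, rfl⟩, by
      rw [dist_eq_norm]; exact not_le.1 hlt⟩) hx
  obtain ⟨A, hA0, hA⟩ := hrep.one_sub_norm_sq_le hδ
  obtain ⟨C, hC0, hC⟩ := exists_norm_sq_le_of_mem_multiplierSpace hself hh
  have hgrowth : ∀ z : ℂ, ‖z‖ < 1 → ‖h z‖ ≤ √C / √(1 - ‖z‖) := by
    intro z hz
    have hz0 : 0 < 1 - ‖z‖ := by linarith
    rw [← Real.sqrt_div hC0]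
    apply Real.le_sqrt_of_sq_le
    refine (hC z hz).trans ?_
    gcongr
    nlinarith [norm_nonneg (φ z)]
  -- The two estimates cancel `1 - ‖z‖`; the factor `2` comes from `1 - ‖z‖² ≤ 2 (1 - ‖z‖)`.
  have hlocal : ∀ p ∈ closure K, ∀ z ∈ Metric.ball (0 : ℂ) 1 ∩ Metric.ball (p : ℂ) (δ / 2),
      ‖h z‖ ≤ (⟨√(C * (A * 2)), Real.sqrt_nonneg _⟩ : ℝ≥0) := by
    intro p hp z hz
    have hz1 : ‖z‖ < 1 := by simpa using hz.1
    have hz0 : 0 < 1 - ‖z‖ := by linarith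
    have h1 := hA p (fun i => by
      rw [norm_sub_rev]; exact hdist p hp _ (Or.inl (subset_closure ⟨i, rfl⟩)))
      (fun t ht => hdist p hp _ (Or.inr ⟨t, ht, rfl⟩)) z hz1 (mem_ball_iff_norm.1 hz.2).le
    apply Real.le_sqrt_of_sq_le
    refine (hC z hz1).trans ?_
    rw [div_le_iff₀ hz0, mul_assoc]
    gcongr
    refine h1.trans ?_
    rw [mul_assoc]
    gcongr
    nlinarith [norm_nonneg z]
  refine ⟨√(C * (A * 2)), ?_⟩
  filter_upwards [ae_hasRadialLimit hh.1.1 (Real.sqrt_nonneg C) hgrowth (half_pos hδ) hlocal]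
    with ζ hζ hζK
  exact hζ (subset_closure hζK)

end HardyDisc

theorem mainTheorem7 {ι : Type*} (φ : ℂ → ℂ) (α : ℝ) (N : ℕ) (a : ι → ℂ) (μ : Measure Circle)
    (hφ : HardyDisc.IsInner φ)
    (hself : MapsTo φ (Metric.ball 0 1) (Metric.ball 0 1))
    (hrep : HardyDisc.IsCanonicalRep φ α N a μ)
    (hzeros : (range a).Infinite → HardyDisc.FiniteUnionNontangential a)
    (hsupp : μ.support.Finite) :
    HardyDisc.ahernClarkSet a μ = {ζ : Circle | (ζ : ℂ) ∉ HardyDisc.innerSpectrum a μ} ∧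
    ∀ h ∈ HardyDisc.multiplierSpace φ, ∀ K : Set Circle,
      IsCompact (closure K) → closure K ⊆ HardyDisc.ahernClarkSet a μ →
      HardyDisc.EssBoundedOn h K := by
  have := hrep.finite
  have hE := HardyDisc.ahernClarkSet_eq hrep.norm_lt_one hrep.blaschke hzeros hsupp
  exact ⟨hE, fun h hh K hK hKE => hrep.essBoundedOn hself hh hK (hE ▸ hKE)⟩
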